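/- **Theorem (Lax pair for the periodic ncILW equation).** Let $L,\delta>0$ and let $$\zeta_1(z)=\frac{\pi}{L}\lim_{M\to\infty}\sum_{n=-M}^{M}\cot\Big(\frac{\pi}{L}(z-2\mathrm{i}n\delta)\Big),$$ $$(Tf)(x)=\frac1\pi\,\mathrm{p.v.}\!\int_{-L/2}^{L/2}\zeta_1(x'-x)f(x')\,dx',\qquad (\tilde Tf)(x)=\frac1\pi\int_{-L/2}^{L/2}\zeta_1(x'-x+\mathrm{i}\delta)f(x')\,dx'.$$ Let $u,v:\mathbb R\times\mathbb R\to\mathbb C$ be smooth functions of $(x,t)$, $L$-periodic in $x$. The periodic ncILW equation is $$u_t+2uu_x+Tu_{xx}+\tilde Tv_{xx}=0,\qquad v_t-2vv_x-Tv_{xx}-\tilde Tu_{xx}=0\qquad (x,t\in\mathbb R).\tag{1}$$ On the torus $\Pi=\mathbb C/(L\mathbb Z+2\mathrm{i}\delta\mathbb Z)$ let $\Pi_0$, $\Pi_\delta$ be the images of $\operatorname{Im}z=0$ and $\operatorname{Im}z=\delta$, and for a function $\psi(z,t)$, $z\in\Pi\setminus(\Pi_0\cup\Pi_\delta)$, let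 $\psi^\pm$ be its boundary values on $\Pi_0\cup\Pi_\delta$ from above ($+$) and below ($-$). Let $\mu,\nu_1,\nu_2,A_0$ be complex numbers, which may depend on a spectral parameter $k\in\mathbb C$. Then, for each $k$, (1) is the compatibility condition of the Lax pair $$\begin{cases} \mathrm{i}\psi_x^-+(-u-\mu)\psi^-=\nu_1\psi^+&\text{on }\Pi_0,\\ \mathrm{i}\psi_x^++(v-\mu)\psi^+=\nu_2\psi^-&\text{on }\Pi_\delta,\\ \psi_t^\pm+\mathrm{i}\psi_{xx}^\pm-2\mu\psi_x^\pm-\mathrm{i}(Tu_x+\tilde Tv_x\pm\mathrm{i}u_x+A_0)\psi^\pm=0&\text{on }\Pi_0,\\ \psi_t^\pm+\mathrm{i}\psi_{xx}^\pm-2\mu\psi_x^\pm-\mathrm{i}(Tv_x+\tilde Tu_x\pm\mathrm{i}v_x+A_0)\psi^\pm=0&\text{on }\Pi_\delta, \end{cases}\tag{2}$$ whose first two equations form the $x$-part and whose last two form the $t$-part, in the following sense. 1. $(u,v)$ solves (1) if and only if (2) is compatible: for every $t_0\in\mathbb R$ and all smooth functions $\psi^\pm(x,t)$, $\psi^\pm(x+\mathrm{i}\delta,t)$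 of $(x,t)\in\mathbb R^2$ that satisfy the $x$-part and the $t$-part at $t=t_0$ (for all $x$), the $t$-derivative of the $x$-part holds at $t=t_0$ (for all $x$). 2. If $\nu_1,\nu_2\neq0$, the same equivalence holds with compatibility required only for functions $\psi^\pm$ that are $L$-periodic in $x$, i.e. functions on $\Pi_0$ and $\Pi_\delta$. 3. Let $\psi(z,t)$, for each $t\in\mathbb R$, be analytic on $\Pi\setminus(\Pi_0\cup\Pi_\delta)$ and extend continuously to $\Pi_0$ and $\Pi_\delta$ from either side, with boundary values $\psi^\pm$ that are smooth in $(x,t)$ and satisfy (2) for all $t$. If for every $t$ the function $\psi(\cdot,t)$ is not identically zero (and, in case $\nu_1=\nu_2=0$, not identically zero on $-\delta<\operatorname{Im}z<0$), then $(u,v)$ solves (1). -/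

import Mathlib

open Filter Topology
open scoped ContDiff

namespace NcILW

noncomputable section

/-- The modified Weierstrass zeta function with periods `L` and `2iδ`, as a symmetric limit:
`ζ₁(z | L/2, iδ) = (π/L) lim_{M → ∞} ∑_{n=-M}^{M} cot ((π/L) (z - 2inδ))`. -/
def zeta1 (L δ : ℝ) (z : ℂ) : ℂ :=
  ((Real.pi / L : ℝ) : ℂ) *
    limUnder atTop (fun M : ℕ =>
      ∑ n ∈ Finset.Icc (-(M : ℤ)) (M : ℤ),
        Complex.cot (((Real.pi / L : ℝ) : ℂ) * (z - 2 * Complex.I * (n : ℂ) * (δ : ℂ))))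

/-- The period interval with the `ε`-neighbourhoods of the poles `x + L ℤ` of the kernel removed. -/
def puncturedPeriod (L x ε : ℝ) : Set ℝ :=
  {y : ℝ | y ∈ Set.Ioc (-(L / 2)) (L / 2) ∧ ∀ m : ℤ, ε < |y - x - (m : ℝ) * L|}

/-- `(T f)(x) = (1/π) p.v. ∫_{-L/2}^{L/2} ζ₁(x' - x) f(x') dx'`. -/
def opT (L δ : ℝ) (f : ℝ → ℂ) (x : ℝ) : ℂ :=
  ((1 / Real.pi : ℝ) : ℂ) *
    limUnder (𝓝[>] (0 : ℝ)) (fun ε : ℝ =>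
      ∫ y in puncturedPeriod L x ε, zeta1 L δ ((y - x : ℝ) : ℂ) * f y)

/-- `(T̃ f)(x) = (1/π) ∫_{-L/2}^{L/2} ζ₁(x' - x + iδ) f(x') dx'`. -/
def opTt (L δ : ℝ) (f : ℝ → ℂ) (x : ℝ) : ℂ :=
  ((1 / Real.pi : ℝ) : ℂ) *
    ∫ y in (-(L / 2))..(L / 2), zeta1 L δ (((y - x : ℝ) : ℂ) + Complex.I * (δ : ℂ)) * f y

/-- Partial derivatives of a function of `(x, t)`. -/
def dx (f : ℝ → ℝ → ℂ) (x t : ℝ) : ℂ := deriv (fun y => f y t) x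

def dt (f : ℝ → ℝ → ℂ) (x t : ℝ) : ℂ := deriv (fun s => f x s) t

/-- Joint smoothness in `(x, t)`. -/
def Smooth (f : ℝ → ℝ → ℂ) : Prop := ContDiff ℝ ∞ (fun p : ℝ × ℝ => f p.1 p.2)

/-- `L`-periodicity in `x`. -/
def XPeriodic (L : ℝ) (f : ℝ → ℝ → ℂ) : Prop := ∀ x t : ℝ, f (x + L) t = f x t

/-- The periodic ncILW equation for `(u, v)`. -/
def IsSolution (L δ : ℝ) (u v : ℝ → ℝ → ℂ) : Prop :=
  ∀ x t : ℝ,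
    dt u x t + 2 * u x t * dx u x t
        + opT L δ (fun y => dx (dx u) y t) x + opTt L δ (fun y => dx (dx v) y t) x = 0 ∧
    dt v x t - 2 * v x t * dx v x t
        - opT L δ (fun y => dx (dx v) y t) x - opTt L δ (fun y => dx (dx u) y t) x = 0

/-- The four boundary functions of an eigenfunction: from above (`pos`) and from below (`neg`)
on `Π₀` (points `x`) and on `Π_δ` (points `x + iδ`), as functions of `(x, t)`. -/
structure ContourData where
  pos₀ : ℝ → ℝ → ℂ
  neg₀ : ℝ → ℝ → ℂ
  posδ : ℝ → ℝ → ℂ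
  negδ : ℝ → ℝ → ℂ

def ContourData.IsSmooth (Ψ : ContourData) : Prop :=
  Smooth Ψ.pos₀ ∧ Smooth Ψ.neg₀ ∧ Smooth Ψ.posδ ∧ Smooth Ψ.negδ

def ContourData.IsPeriodic (L : ℝ) (Ψ : ContourData) : Prop :=
  XPeriodic L Ψ.pos₀ ∧ XPeriodic L Ψ.neg₀ ∧ XPeriodic L Ψ.posδ ∧ XPeriodic L Ψ.negδ

/-- Left-hand side minus right-hand side of `i ψ⁻_x + (-u - μ) ψ⁻ = ν₁ ψ⁺` on `Π₀`. -/
def xDefect₀ (u : ℝ → ℝ → ℂ) (μ ν₁ : ℂ) (Ψ : ContourData) (x t : ℝ) : ℂ :=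
  Complex.I * dx Ψ.neg₀ x t + (-u x t - μ) * Ψ.neg₀ x t - ν₁ * Ψ.pos₀ x t

/-- Left-hand side minus right-hand side of `i ψ⁺_x + (v - μ) ψ⁺ = ν₂ ψ⁻` on `Π_δ`. -/
def xDefectδ (v : ℝ → ℝ → ℂ) (μ ν₂ : ℂ) (Ψ : ContourData) (x t : ℝ) : ℂ :=
  Complex.I * dx Ψ.posδ x t + (v x t - μ) * Ψ.posδ x t - ν₂ * Ψ.negδ x t

/-- The `x`-part of the Lax pair holds at time `t`. -/
def XPart (u v : ℝ → ℝ → ℂ) (μ ν₁ ν₂ : ℂ) (Ψ : ContourData) (t : ℝ) : Prop :=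
  ∀ x : ℝ, xDefect₀ u μ ν₁ Ψ x t = 0 ∧ xDefectδ v μ ν₂ Ψ x t = 0

/-- `φ_t + i φ_xx - 2 μ φ_x - i (T f_x + T̃ g_x + σ i f_x + A₀) φ = 0` at the point `(x, t)`. -/
def TEquation (L δ : ℝ) (f g : ℝ → ℝ → ℂ) (μ A₀ σ : ℂ) (φ : ℝ → ℝ → ℂ) (x t : ℝ) : Prop :=
  dt φ x t + Complex.I * dx (dx φ) x t - 2 * μ * dx φ x t
    - Complex.I * (opT L δ (fun y => dx f y t) x + opTt L δ (fun y => dx g y t) x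
        + σ * (Complex.I * dx f x t) + A₀) * φ x t = 0

/-- The `t`-part of the Lax pair (the four equations on `Π₀` and `Π_δ`) holds at time `t`. -/
def TPart (L δ : ℝ) (u v : ℝ → ℝ → ℂ) (μ A₀ : ℂ) (Ψ : ContourData) (t : ℝ) : Prop :=
  ∀ x : ℝ,
    TEquation L δ u v μ A₀ 1 Ψ.pos₀ x t ∧ TEquation L δ u v μ A₀ (-1) Ψ.neg₀ x t ∧
    TEquation L δ v u μ A₀ 1 Ψ.posδ x t ∧ TEquation L δ v u μ A₀ (-1) Ψ.negδ x t

/-- The `t`-derivative of the `x`-part holds at time `t`. -/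
def XPartDifferentiated (u v : ℝ → ℝ → ℂ) (μ ν₁ ν₂ : ℂ) (Ψ : ContourData) (t : ℝ) : Prop :=
  ∀ x : ℝ, dt (xDefect₀ u μ ν₁ Ψ) x t = 0 ∧ dt (xDefectδ v μ ν₂ Ψ) x t = 0

/-- Compatibility of the Lax pair (cross-differentiation): for arbitrary smooth data on the lines
`Im z = 0` and `Im z = δ` which at a time `t₀` satisfy the `x`-part and whose `t`-derivatives at
`t₀` are those prescribed by the `t`-part, the `t`-derivative of the `x`-part holds at `t₀`. -/
def Compatible (L δ : ℝ) (u v : ℝ → ℝ → ℂ) (μ ν₁ ν₂ A₀ : ℂ) : Prop :=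
  ∀ (Ψ : ContourData) (t₀ : ℝ), Ψ.IsSmooth →
    XPart u v μ ν₁ ν₂ Ψ t₀ → TPart L δ u v μ A₀ Ψ t₀ → XPartDifferentiated u v μ ν₁ ν₂ Ψ t₀

/-- The same with `L`-periodic data only, that is, for data on the closed curves `Π₀`, `Π_δ`. -/
def CompatiblePeriodic (L δ : ℝ) (u v : ℝ → ℝ → ℂ) (μ ν₁ ν₂ A₀ : ℂ) : Prop :=
  ∀ (Ψ : ContourData) (t₀ : ℝ), Ψ.IsSmooth → Ψ.IsPeriodic L →
    XPart u v μ ν₁ ν₂ Ψ t₀ → TPart L δ u v μ A₀ Ψ t₀ → XPartDifferentiated u v μ ν₁ ν₂ Ψ t₀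

/-- Complement of the preimage in `ℂ` of `Π₀ ∪ Π_δ` under `ℂ → ℂ / (L ℤ + 2iδ ℤ)`. -/
def offContour (δ : ℝ) : Set ℂ := {z : ℂ | ∀ n : ℤ, z.im ≠ (n : ℝ) * δ}

/-- `ψ(z, t)` is an eigenfunction of the Lax pair: a doubly periodic function of `z`, i.e. a
function on the torus `ℂ / (L ℤ + 2iδ ℤ)`, analytic off `Π₀ ∪ Π_δ`, extending continuously to
`Π₀` and `Π_δ` from each side, with boundary values `Ψ` that are smooth in `(x, t)` and satisfy
the `x`-part and the `t`-part for all times. -/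
structure IsEigenfunction (L δ : ℝ) (u v : ℝ → ℝ → ℂ) (μ ν₁ ν₂ A₀ : ℂ)
    (ψ : ℂ → ℝ → ℂ) (Ψ : ContourData) : Prop where
  periodic_real : ∀ (z : ℂ) (t : ℝ), ψ (z + (L : ℂ)) t = ψ z t
  periodic_imag : ∀ (z : ℂ) (t : ℝ), ψ (z + 2 * Complex.I * (δ : ℂ)) t = ψ z t
  analytic : ∀ t : ℝ, DifferentiableOn ℂ (fun z => ψ z t) (offContour δ)
  boundary_pos₀ : ∀ x t : ℝ,
    Tendsto (fun z => ψ z t) (𝓝[{z : ℂ | 0 < z.im}] (x : ℂ)) (𝓝 (Ψ.pos₀ x t))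
  boundary_neg₀ : ∀ x t : ℝ,
    Tendsto (fun z => ψ z t) (𝓝[{z : ℂ | z.im < 0}] (x : ℂ)) (𝓝 (Ψ.neg₀ x t))
  boundary_posδ : ∀ x t : ℝ,
    Tendsto (fun z => ψ z t) (𝓝[{z : ℂ | δ < z.im}] ((x : ℂ) + Complex.I * (δ : ℂ)))
      (𝓝 (Ψ.posδ x t))
  boundary_negδ : ∀ x t : ℝ,
    Tendsto (fun z => ψ z t) (𝓝[{z : ℂ | z.im < δ}] ((x : ℂ) + Complex.I * (δ : ℂ)))
      (𝓝 (Ψ.negδ x t))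
  smooth : Ψ.IsSmooth
  xPart : ∀ t : ℝ, XPart u v μ ν₁ ν₂ Ψ t
  tPart : ∀ t : ℝ, TPart L δ u v μ A₀ Ψ t

end

end NcILW

/-! Everything rests on one cross-differentiation identity (`dt_xDefect`). Let `D = iφ_x + (-q - μ)φ
- νχ` be the defect of the `x`-part on one contour, and let `φ`, `χ` satisfy `t`-equations with
potentials `W - i q_x + A` and `W + i q_x + A`. Where `D = 0` for all `x` at the given time, all
derivatives of `φ` and `χ` cancel and `D_t = -(q_t + 2 q q_x + W') φ`. With `q = u`, `φ = ψ⁻` on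
`Π₀`, and with `q = -v`, `φ = ψ⁺` on `Π_δ`, the bracket is, up to sign, the left-hand side of an
ncILW equation, provided that `T` and `T̃` commute with `d/dx`.

Commutation is the analytic part. Pairing the terms `n` and `-n` makes the cotangent series converge
absolutely and bounds the kernel by `C/s` on the real line. As the kernel is odd and periodic, the
principal value becomes an integral of `ζ₁(s)(f(x+s) - f(x-s))` over `(0, L/2)` with bounded
integrand (`opT_eq`), and one differentiates under the integral sign.

A solution therefore makes the pair compatible. Conversely, the factor `φ` must be removed. For
arbitrary data, `φ` is taken to be a nowhere vanishing exponential with `χ = 0`; for periodic data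
and `ν ≠ 0`, `φ = 1`, and the `x`-part is solved for `χ`. For an eigenfunction, a nonzero left-hand
side at one point would, by continuity, force `φ` to vanish on an interval. Extension by zero and
the identity theorem then make `ψ` vanish on the strip `-δ < Im z < 0`, which `exists_ne_zero`
excludes. -/

namespace NcILW

/-! ### Boundary uniqueness for holomorphic functions on strips -/

open Complex Set in
/-- Extension by zero across the real line of a function holomorphic above it. -/
theorem differentiableOn_extend_by_zero {F : ℂ → ℂ} {b p q : ℝ} (hb : 0 < b)
    (hF : DifferentiableOn ℂ F {z : ℂ | 0 < z.im ∧ z.im < b})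
    (h0 : ∀ x ∈ Ioo p q, Tendsto F (𝓝[{z : ℂ | 0 < z.im}] (x : ℂ)) (𝓝 0)) :
    DifferentiableOn ℂ (fun z : ℂ => if 0 < z.im then F z else 0)
      {z : ℂ | (p < z.re ∧ z.re < q) ∧ z.im < b} := by
  set G : ℂ → ℂ := fun z : ℂ => if 0 < z.im then F z else 0 with hG
  set U : Set ℂ := {z : ℂ | (p < z.re ∧ z.re < q) ∧ z.im < b} with hU
  have hGpos : ∀ z : ℂ, 0 < z.im → G z = F z := fun z hz => if_pos hz
  have hGneg : ∀ z : ℂ, z.im ≤ 0 → G z = 0 := fun z hz => if_neg (not_lt.2 hz)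
  have hSo : IsOpen {z : ℂ | 0 < z.im ∧ z.im < b} :=
    (isOpen_lt continuous_const continuous_im).inter (isOpen_lt continuous_im continuous_const)
  have hUo : IsOpen U :=
    ((isOpen_lt continuous_const continuous_re).inter
      (isOpen_lt continuous_re continuous_const)).inter (isOpen_lt continuous_im continuous_const)
  have hdiff : ∀ z : ℂ, 0 < z.im → z.im < b → DifferentiableAt ℂ G z := by
    intro z h1 h2
    have h3 : DifferentiableAt ℂ F z := hF.differentiableAt (hSo.mem_nhds ⟨h1, h2⟩)
    refine h3.congr_of_eventuallyEq ?_
    filter_upwards [hSo.mem_nhds (show z ∈ {z : ℂ | 0 < z.im ∧ z.im < b} from ⟨h1, h2⟩)] with w hw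
    exact hGpos w hw.1
  have hcont : ContinuousOn G U := by
    intro z hz
    apply ContinuousAt.continuousWithinAt
    rcases lt_trichotomy z.im 0 with h | h | h
    · have : G =ᶠ[𝓝 z] fun _ => 0 := by
        filter_upwards [(isOpen_lt continuous_im continuous_const).mem_nhds h] with w hw
        exact hGneg w (le_of_lt hw)
      exact continuousAt_const.congr this.symm
    · have hzr : z = ((z.re : ℝ) : ℂ) := by
        apply Complex.ext <;> simp [h]
      have h1 : Tendsto G (𝓝[{z : ℂ | 0 < z.im}] z) (𝓝 0) := by
        have := h0 z.re hz.1
        rw [← hzr] at this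
        refine this.congr' ?_
        filter_upwards [self_mem_nhdsWithin] with w hw
        exact (hGpos w hw).symm
      have h2 : Tendsto G (𝓝[{z : ℂ | 0 < z.im}ᶜ] z) (𝓝 0) := by
        refine tendsto_const_nhds.congr' ?_
        filter_upwards [self_mem_nhdsWithin] with w hw
        exact (hGneg w (not_lt.1 hw)).symm
      have h3 := h1.sup h2
      rw [← nhdsWithin_union, union_compl_self, nhdsWithin_univ] at h3
      rw [ContinuousAt, hGneg z h.le]
      exact h3
    · exact (hdiff z h hz.2).continuousAt
  -- Morera's theorem: it remains to show that integrals over rectangles vanish.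
  refine (isConservativeOn_and_continuousOn_iff_isDifferentiableOn hUo).1 ⟨?_, hcont⟩
  intro z w hzw
  have hz : z ∈ U := hzw (by simp [Rectangle, mem_reProdIm])
  have hw : w ∈ U := hzw (by simp [Rectangle, mem_reProdIm])
  -- Since `G` vanishes for `Im z ≤ 0`, a rectangle may be replaced by its part in the closed upper
  -- half-plane. The interior of that part lies in `Im z > 0`, where `G` is holomorphic, so Cauchy's
  -- theorem applies with mere continuity on the boundary.
  have hclamp : ∀ x a b : ℝ, (∫ y in a..b, G (x + y * I)) =
      ∫ y in (max a 0)..(max b 0), G (x + y * I) := by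
    intro x
    have h1 : ∀ y : ℝ, y ≤ 0 → G (x + y * I) = 0 := fun y hy => hGneg _ (by simpa using hy)
    have h2 : ∀ a b : ℝ, a ≤ b → (∫ y in a..b, G (x + y * I)) =
        ∫ y in (max a 0)..(max b 0), G (x + y * I) := by
      intro a b hab
      rw [intervalIntegral.integral_of_le hab,
        intervalIntegral.integral_of_le (max_le_max_right 0 hab)]
      refine MeasureTheory.setIntegral_eq_of_subset_of_forall_sdiff_eq_zero measurableSet_Ioc
        (fun y hy => ?_) (fun y hy => h1 y ?_)
      · have h3 := max_lt_iff.1 hy.1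
        exact ⟨h3.1, (le_max_iff.1 hy.2).resolve_right (not_le.2 h3.2)⟩
      · by_contra hy0
        push Not at hy0
        exact hy.2 ⟨max_lt hy.1.1 hy0, le_max_of_le_left hy.1.2⟩
    intro a b
    rcases le_total a b with hab | hab
    · exact h2 a b hab
    · rw [intervalIntegral.integral_symm, h2 b a hab, ← intervalIntegral.integral_symm]
  have hclamp' : ∀ a b y : ℝ, (∫ x in a..b, G (x + y * I)) =
      ∫ x in a..b, G (x + (max y 0 : ℝ) * I) := by
    intro a b y
    rcases le_total y 0 with h | h
    · have e1 : ∀ x : ℝ, G (x + y * I) = 0 := fun x => hGneg _ (by simpa using h)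
      have e2 : ∀ x : ℝ, G (x + (max y 0 : ℝ) * I) = 0 := fun x => hGneg _ (by simp [h])
      simp only [e1, e2]
    · rw [max_eq_left h]
  have key := integral_boundary_rect_eq_zero_of_continuousOn_of_differentiableOn G
    (⟨z.re, max z.im 0⟩ : ℂ) (⟨w.re, max w.im 0⟩ : ℂ) ?_ ?_
  · simp only [wedgeIntegral]
    rw [hclamp w.re, hclamp z.re, hclamp' z.re, hclamp' w.re]
    rw [intervalIntegral.integral_symm z.re w.re, intervalIntegral.integral_symm (max z.im 0)]
    simp only [smul_eq_mul] at key ⊢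
    linear_combination key
  · refine hcont.mono ?_
    rintro c ⟨hc1, hc2⟩
    have h1 := hc1.1
    have h2 := hc1.2
    have h3 := hc2.2
    simp only [] at h1 h2 h3
    exact ⟨⟨lt_of_lt_of_le (lt_min hz.1.1 hw.1.1) h1, lt_of_le_of_lt h2 (max_lt hz.1.2 hw.1.2)⟩,
      lt_of_le_of_lt h3 (max_lt (max_lt hz.2 hb) (max_lt hw.2 hb))⟩
  · rintro c ⟨hc1, hc2⟩
    have h1 := hc2.1
    have h2 := hc2.2
    simp only [] at h1 h2
    refine (hdiff c ?_ ?_).differentiableWithinAt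
    · exact lt_of_le_of_lt (le_min (le_max_right _ _) (le_max_right _ _)) h1
    · exact lt_trans h2 (max_lt (max_lt hz.2 hb) (max_lt hw.2 hb))

open Complex Set in
/-- A holomorphic function on a horizontal strip whose boundary values vanish on an interval of the
lower edge vanishes identically. -/
theorem eq_zero_of_tendsto_zero_lower {F : ℂ → ℂ} {a b p q : ℝ} (hpq : p < q)
    (hF : DifferentiableOn ℂ F {z : ℂ | a < z.im ∧ z.im < b})
    (h0 : ∀ x ∈ Ioo p q, Tendsto F (𝓝[{z : ℂ | a < z.im}] ((x : ℂ) + a * I)) (𝓝 0))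
    {z : ℂ} (hza : a < z.im) (hzb : z.im < b) : F z = 0 := by
  set H : ℂ → ℂ := fun z => F (z + a * I) with hH
  have hb : 0 < b - a := by linarith
  have hHd : DifferentiableOn ℂ H {z : ℂ | 0 < z.im ∧ z.im < b - a} := by
    refine hF.comp (by fun_prop) ?_
    rintro w ⟨h1, h2⟩
    constructor <;> simp <;> linarith
  have hH0 : ∀ x ∈ Ioo p q, Tendsto H (𝓝[{z : ℂ | 0 < z.im}] (x : ℂ)) (𝓝 0) := by
    intro x hx
    refine (h0 x hx).comp (tendsto_nhdsWithin_iff.2 ⟨?_, ?_⟩)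
    · exact ((continuous_id.add continuous_const).tendsto (x : ℂ)).mono_left nhdsWithin_le_nhds
    · filter_upwards [self_mem_nhdsWithin] with w hw
      simpa using hw
  have hG := differentiableOn_extend_by_zero hb hHd hH0
  set G : ℂ → ℂ := fun z : ℂ => if 0 < z.im then H z else 0 with hGdef
  set U : Set ℂ := {z : ℂ | (p < z.re ∧ z.re < q) ∧ z.im < b - a} with hU
  have hUo : IsOpen U :=
    ((isOpen_lt continuous_const continuous_re).inter
      (isOpen_lt continuous_re continuous_const)).inter (isOpen_lt continuous_im continuous_const)
  have hUc : Convex ℝ U :=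
    ((convex_halfSpace_re_gt p).inter (convex_halfSpace_re_lt q)).inter (convex_halfSpace_im_lt _)
  have hm1 : p < (p + q) / 2 := by linarith
  have hm2 : (p + q) / 2 < q := by linarith
  have hG0 : EqOn G 0 U := by
    -- The base point lies below the real line, where the extension is zero by construction; the
    -- identity theorem carries this up into the strip.
    refine (hG.analyticOnNhd hUo).eqOn_zero_of_preconnected_of_eventuallyEq_zero
      hUc.isPreconnected (z₀ := ⟨(p + q) / 2, -1⟩) ⟨⟨hm1, hm2⟩, by simp; linarith⟩ ?_
    filter_upwards [(isOpen_lt continuous_im continuous_const).mem_nhds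
      (show (⟨(p + q) / 2, -1⟩ : ℂ).im < 0 by simp)] with w hw
    exact if_neg (not_lt.2 (le_of_lt hw))
  set S : Set ℂ := {z : ℂ | 0 < z.im ∧ z.im < b - a} with hS
  have hSo : IsOpen S :=
    (isOpen_lt continuous_const continuous_im).inter (isOpen_lt continuous_im continuous_const)
  have hSc : Convex ℝ S := (convex_halfSpace_im_gt 0).inter (convex_halfSpace_im_lt _)
  have hmS : (⟨(p + q) / 2, (b - a) / 2⟩ : ℂ) ∈ S := ⟨by simp; linarith, by simp; linarith⟩
  have hmU : (⟨(p + q) / 2, (b - a) / 2⟩ : ℂ) ∈ U := ⟨⟨hm1, hm2⟩, hmS.2⟩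
  have hH : EqOn H 0 S := by
    refine (hHd.analyticOnNhd hSo).eqOn_zero_of_preconnected_of_eventuallyEq_zero
      hSc.isPreconnected hmS ?_
    filter_upwards [hSo.mem_nhds hmS, hUo.mem_nhds hmU] with w hw1 hw2
    have := hG0 hw2
    exact (if_pos hw1.1).symm.trans this
  have := hH (show z - a * I ∈ S from ⟨by simpa using hza, by simpa using hzb⟩)
  simpa [H] using this

open Complex Set in
/-- The same for the upper edge. -/
theorem eq_zero_of_tendsto_zero_upper {F : ℂ → ℂ} {a b p q : ℝ} (hpq : p < q)
    (hF : DifferentiableOn ℂ F {z : ℂ | a < z.im ∧ z.im < b})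
    (h0 : ∀ x ∈ Ioo p q, Tendsto F (𝓝[{z : ℂ | z.im < b}] ((x : ℂ) + b * I)) (𝓝 0))
    {z : ℂ} (hza : a < z.im) (hzb : z.im < b) : F z = 0 := by
  have := eq_zero_of_tendsto_zero_lower (F := fun z => F (-z)) (a := -b) (b := -a)
    (p := -q) (q := -p) (neg_lt_neg hpq) ?_ ?_ (z := -z) (by simpa using hzb) (by simpa using hza)
  · simpa using this
  · refine hF.comp (by fun_prop) ?_
    rintro w ⟨h1, h2⟩
    constructor <;> simp <;> linarith
  · intro x hx
    have := h0 (-x) ⟨by linarith [hx.2], by linarith [hx.1]⟩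
    refine this.comp (tendsto_nhdsWithin_iff.2 ⟨?_, ?_⟩)
    · have h1 := (continuous_neg.tendsto ((x : ℂ) + (-b : ℝ) * I)).mono_left
        (nhdsWithin_le_nhds (s := {z : ℂ | -b < z.im}))
      convert h1 using 2
      push_cast
      ring
    · filter_upwards [self_mem_nhdsWithin] with w hw
      have : -b < w.im := hw
      simp
      linarith

/-! ### Convergence and size of the kernel -/

theorem cot_neg (z : ℂ) : Complex.cot (-z) = -Complex.cot z := by
  simp [Complex.cot, div_neg]

theorem cot_add_pi (z : ℂ) : Complex.cot (z + Real.pi) = Complex.cot z := by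
  simp [Complex.cot, Complex.cos_add_pi, Complex.sin_add_pi]

/-- `cot w` tends to `-i` at `+i∞`. -/
theorem norm_cot_add_I_le {w : ℂ} (hw : 0 < w.im) :
    ‖Complex.cot w + Complex.I‖ ≤ 1 / w.im ^ 2 := by
  set q := Complex.exp (2 * Complex.I * w) with hq
  have hr : ‖q‖ = Real.exp (-(2 * w.im)) := by
    rw [hq, Complex.norm_exp]
    simp
  have hr0 : 0 < ‖q‖ := hr ▸ Real.exp_pos _
  -- From `e^{2y} ≥ 1 + 2y + 2y²` with `y = Im w`. It gives `2‖q‖y² ≤ 1 - ‖q‖`, exactly the bound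
  -- needed for `2‖q‖/(1 - ‖q‖)`.
  have hexp : ‖q‖ * (1 + 2 * w.im ^ 2) ≤ 1 := by
    have h1 := Real.quadratic_le_exp_of_nonneg (x := 2 * w.im) (by linarith)
    have h2 : ‖q‖ * Real.exp (2 * w.im) = 1 := by
      rw [hr, ← Real.exp_add]
      simp
    rw [← h2]
    gcongr
    nlinarith
  have hw2 : 0 < w.im ^ 2 := by positivity
  have hlt : 0 < 1 - ‖q‖ := by nlinarith [mul_pos hr0 hw2]
  have hle : 1 - ‖q‖ ≤ ‖1 - q‖ := by
    simpa using norm_sub_norm_le 1 q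
  have hne : 1 - q ≠ 0 := norm_pos_iff.1 (hlt.trans_le hle)
  have e : Complex.cot w + Complex.I = 2 * q / (Complex.I * (1 - q)) := by
    rw [Complex.cot_eq_exp_ratio, ← hq]
    field_simp
    rw [Complex.I_sq]
    ring
  rw [e, norm_div, norm_mul, norm_mul, Complex.norm_I, one_mul, Complex.norm_ofNat,
    div_le_div_iff₀ (hlt.trans_le hle) hw2]
  nlinarith

theorem norm_cot_sub_I_le {w : ℂ} (hw : w.im < 0) :
    ‖Complex.cot w - Complex.I‖ ≤ 1 / w.im ^ 2 := by
  have h := norm_cot_add_I_le (w := -w) (by simpa using hw)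
  rw [cot_neg, ← norm_neg] at h
  simpa [sub_eq_neg_add] using h

/-- The partial sums of the series defining `zeta1`. -/
noncomputable def cotSum (L δ : ℝ) (M : ℕ) (z : ℂ) : ℂ :=
  ∑ n ∈ Finset.Icc (-(M : ℤ)) (M : ℤ),
    Complex.cot (((Real.pi / L : ℝ) : ℂ) * (z - 2 * Complex.I * (n : ℂ) * (δ : ℂ)))

/-- The sum of the terms with indices `n + 1` and `-(n + 1)`. -/
noncomputable def cotPair (L δ : ℝ) (n : ℕ) (z : ℂ) : ℂ :=
  Complex.cot (((Real.pi / L : ℝ) : ℂ) * (z - 2 * Complex.I * (n + 1 : ℂ) * (δ : ℂ))) +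
    Complex.cot (((Real.pi / L : ℝ) : ℂ) * (z + 2 * Complex.I * (n + 1 : ℂ) * (δ : ℂ)))

theorem cotSum_eq (L δ : ℝ) (M : ℕ) (z : ℂ) :
    cotSum L δ M z =
      Complex.cot (((Real.pi / L : ℝ) : ℂ) * z) + ∑ n ∈ Finset.range M, cotPair L δ n z := by
  induction M with
  | zero => simp [cotSum]
  | succ M ih =>
    rw [Finset.sum_range_succ, ← add_assoc, ← ih, cotSum, cotSum]
    have h : Finset.Icc (-((M + 1 : ℕ) : ℤ)) ((M + 1 : ℕ) : ℤ) =
        insert ((M : ℤ) + 1) (insert (-((M : ℤ) + 1)) (Finset.Icc (-(M : ℤ)) (M : ℤ))) := by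
      ext k
      simp only [Finset.mem_Icc, Finset.mem_insert]
      push_cast
      omega
    rw [h, Finset.sum_insert, Finset.sum_insert, cotPair]
    · push_cast
      ring_nf
    · simp
    · simp only [Finset.mem_Icc, Finset.mem_insert]
      omega

/-- The limits `i` and `-i` of the cotangent at `-i∞` and `+i∞` cancel within a pair. As `|Im z| ≤
δ`, both arguments have distance at least `(π/L)δ(n+1)` from the real axis, so the remainder is of
order `1/n²`. -/
theorem norm_cotPair_le {L δ : ℝ} (hL : 0 < L) (hδ : 0 < δ) {z : ℂ} (hz : |z.im| ≤ δ) (n : ℕ) :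
    ‖cotPair L δ n z‖ ≤ 2 / (Real.pi / L * δ) ^ 2 * (1 / ((n + 1 : ℕ) : ℝ) ^ 2) := by
  have hc : 0 < Real.pi / L := by positivity
  obtain ⟨h1, h2⟩ := abs_le.1 hz
  have hβ : 0 < Real.pi / L * δ * (n + 1) := by positivity
  have key : ∀ w : ℂ, Real.pi / L * δ * (n + 1) ≤ |w.im| →
      1 / w.im ^ 2 ≤ 1 / (Real.pi / L * δ * (n + 1)) ^ 2 := by
    intro w hw
    rw [← sq_abs w.im]
    gcongr
  set w₁ := ((Real.pi / L : ℝ) : ℂ) * (z - 2 * Complex.I * (n + 1 : ℂ) * (δ : ℂ)) with hw₁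
  set w₂ := ((Real.pi / L : ℝ) : ℂ) * (z + 2 * Complex.I * (n + 1 : ℂ) * (δ : ℂ)) with hw₂
  have e1 : w₁.im = Real.pi / L * (z.im - 2 * (n + 1) * δ) := by
    rw [hw₁, Complex.im_ofReal_mul]
    simp
  have e2 : w₂.im = Real.pi / L * (z.im + 2 * (n + 1) * δ) := by
    rw [hw₂, Complex.im_ofReal_mul]
    simp
  have hn : 0 ≤ (n : ℝ) * δ := by positivity
  have b1 : w₁.im ≤ -(Real.pi / L * δ * (n + 1)) := by
    rw [e1]; nlinarith
  have b2 : Real.pi / L * δ * (n + 1) ≤ w₂.im := by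
    rw [e2]; nlinarith
  have i1 := (norm_cot_sub_I_le (w := w₁) (by linarith)).trans
    (key w₁ (by rw [abs_of_neg (by linarith)]; linarith))
  have i2 := (norm_cot_add_I_le (w := w₂) (by linarith)).trans
    (key w₂ (b2.trans (le_abs_self _)))
  have : cotPair L δ n z = (Complex.cot w₁ - Complex.I) + (Complex.cot w₂ + Complex.I) := by
    rw [cotPair]; ring
  rw [this]
  refine (norm_add_le _ _).trans ((add_le_add i1 i2).trans (le_of_eq ?_))
  push_cast
  field_simp
  ring

theorem summable_pairBound (L δ : ℝ) :
    Summable fun n : ℕ => 2 / (Real.pi / L * δ) ^ 2 * (1 / ((n + 1 : ℕ) : ℝ) ^ 2) :=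
  ((summable_nat_add_iff 1).2 (Real.summable_one_div_nat_pow.2 one_lt_two)).mul_left _

theorem tendsto_cotSum {L δ : ℝ} (hL : 0 < L) (hδ : 0 < δ) {z : ℂ} (hz : |z.im| ≤ δ) :
    Tendsto (fun M => cotSum L δ M z) atTop
      (𝓝 (Complex.cot (((Real.pi / L : ℝ) : ℂ) * z) + ∑' n, cotPair L δ n z)) := by
  simp only [cotSum_eq]
  exact tendsto_const_nhds.add
    ((summable_pairBound L δ).of_norm_bounded (norm_cotPair_le hL hδ hz)).hasSum.tendsto_sum_nat

theorem zeta1_eq {L δ : ℝ} (hL : 0 < L) (hδ : 0 < δ) {z : ℂ} (hz : |z.im| ≤ δ) :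
    zeta1 L δ z = ((Real.pi / L : ℝ) : ℂ) *
      (Complex.cot (((Real.pi / L : ℝ) : ℂ) * z) + ∑' n, cotPair L δ n z) :=
  congrArg _ (tendsto_cotSum hL hδ hz).limUnder_eq

theorem tendsto_zeta1 {L δ : ℝ} (hL : 0 < L) (hδ : 0 < δ) {z : ℂ} (hz : |z.im| ≤ δ) :
    Tendsto (fun M => ((Real.pi / L : ℝ) : ℂ) * cotSum L δ M z) atTop (𝓝 (zeta1 L δ z)) := by
  rw [zeta1_eq hL hδ hz]
  exact (tendsto_cotSum hL hδ hz).const_mul _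

theorem zeta1_neg {L δ : ℝ} (hL : 0 < L) (hδ : 0 < δ) {z : ℂ} (hz : |z.im| ≤ δ) :
    zeta1 L δ (-z) = -zeta1 L δ z := by
  refine tendsto_nhds_unique (tendsto_zeta1 hL hδ (z := -z) (by simpa using hz)) ?_
  refine (tendsto_zeta1 hL hδ hz).neg.congr fun M => ?_
  rw [cotSum_eq, cotSum_eq, ← mul_neg, mul_neg _ z, cot_neg, neg_add, ← Finset.sum_neg_distrib]
  congr 2
  refine Finset.sum_congr rfl fun n _ => ?_
  rw [cotPair, cotPair, neg_add, ← cot_neg, ← cot_neg, add_comm]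
  ring_nf

/-- The symmetric partial sums are already periodic term by term, so convergence plays no role. -/
theorem zeta1_add_period {L : ℝ} (hL : 0 < L) (δ : ℝ) (z : ℂ) :
    zeta1 L δ (z + L) = zeta1 L δ z := by
  have hL' : (L : ℂ) ≠ 0 := by exact_mod_cast hL.ne'
  unfold zeta1
  congr 2
  funext M
  refine Finset.sum_congr rfl fun n _ => ?_
  rw [← cot_add_pi (_ * (z - _))]
  congr 1
  push_cast
  field_simp
  ring

/-- A pointwise limit of quotients of continuous functions; at poles division by zero gives `0`,
which does not disturb the limit. Dominated convergence asks no more regularity of the kernel than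
this. -/
theorem measurable_zeta1_line {L δ : ℝ} (hL : 0 < L) (hδ : 0 < δ) {w : ℂ} (hw : |w.im| ≤ δ) :
    Measurable fun s : ℝ => zeta1 L δ ((s : ℂ) + w) := by
  refine measurable_of_tendsto_metrizable
    (f := fun M (s : ℝ) => ((Real.pi / L : ℝ) : ℂ) * cotSum L δ M ((s : ℂ) + w)) (fun M => ?_)
    (tendsto_pi_nhds.2 fun s => tendsto_zeta1 hL hδ (by simpa using hw))
  refine Measurable.const_mul (Finset.measurable_sum _ fun n _ => ?_) _
  unfold Complex.cot
  refine Measurable.div (Continuous.measurable ?_) (Continuous.measurable ?_) <;> fun_prop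

theorem exists_zeta1_bound {L δ : ℝ} (hL : 0 < L) (hδ : 0 < δ) :
    ∃ K : ℝ, 0 ≤ K ∧ ∀ z : ℂ, |z.im| ≤ δ →
      ‖zeta1 L δ z‖ ≤ Real.pi / L * (‖Complex.cot (((Real.pi / L : ℝ) : ℂ) * z)‖ + K) := by
  refine ⟨∑' n : ℕ, 2 / (Real.pi / L * δ) ^ 2 * (1 / ((n + 1 : ℕ) : ℝ) ^ 2),
    tsum_nonneg (fun n : ℕ => by positivity), fun z hz => ?_⟩
  rw [zeta1_eq hL hδ hz, norm_mul, Complex.norm_real, Real.norm_of_nonneg (by positivity)]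
  gcongr
  refine (norm_add_le _ _).trans ?_
  gcongr
  exact tsum_of_norm_bounded (summable_pairBound L δ).hasSum (norm_cotPair_le hL hδ hz)

/-- On the real line the kernel has a simple pole only. -/
theorem exists_zeta1_real_bound {L δ : ℝ} (hL : 0 < L) (hδ : 0 < δ) :
    ∃ C : ℝ, 0 ≤ C ∧ ∀ s : ℝ, 0 < s → s ≤ L / 2 → ‖zeta1 L δ s‖ ≤ C / s := by
  obtain ⟨K, hK, h⟩ := exists_zeta1_bound hL hδ
  have hpi := Real.pi_pos
  -- On `(0, L/2]`, Jordan's inequality gives `sin(πs/L) ≥ s/(L/2)`, hence `|cot(πs/L)| ≤ (L/2)/s`,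
  -- while `K ≤ K(L/2)/s`.
  refine ⟨Real.pi / L * (L / 2 + K * (L / 2)), by positivity, fun s hs hsL => ?_⟩
  refine (h s (by simpa using hδ.le)).trans ?_
  rw [mul_div_assoc, add_div]
  gcongr
  · have h1 : ((Real.pi / L : ℝ) : ℂ) * s = ((Real.pi / L * s : ℝ) : ℂ) := by push_cast; ring
    have hx0 : 0 ≤ Real.pi / L * s := by positivity
    have hx1 : Real.pi / L * s ≤ Real.pi / 2 := by
      calc Real.pi / L * s ≤ Real.pi / L * (L / 2) := by gcongr
        _ = Real.pi / 2 := by field_simp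
    have h2 := Real.mul_le_sin hx0 hx1
    have h3 : 2 / Real.pi * (Real.pi / L * s) = s / (L / 2) := by field_simp
    rw [h3] at h2
    have h4 : 0 < s / (L / 2) := by positivity
    rw [h1, Complex.cot, ← Complex.ofReal_cos, ← Complex.ofReal_sin, norm_div, Complex.norm_real,
      Complex.norm_real, Real.norm_of_nonneg (h4.le.trans h2)]
    calc ‖Real.cos (Real.pi / L * s)‖ / Real.sin (Real.pi / L * s)
        ≤ 1 / (s / (L / 2)) := by
          gcongr
          exact Real.abs_cos_le_one _
      _ = L / 2 / s := by field_simp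
  · rw [le_div_iff₀ hs]
    gcongr

theorem exists_zeta1_shifted_bound {L δ : ℝ} (hL : 0 < L) (hδ : 0 < δ) :
    ∃ C : ℝ, ∀ s : ℝ, ‖zeta1 L δ ((s : ℂ) + Complex.I * δ)‖ ≤ C := by
  obtain ⟨K, hK, h⟩ := exists_zeta1_bound hL hδ
  refine ⟨Real.pi / L * ((1 / (Real.pi / L * δ) ^ 2 + 1) + K), fun s => ?_⟩
  refine (h _ (by simp [abs_of_pos hδ])).trans ?_
  set w := ((Real.pi / L : ℝ) : ℂ) * ((s : ℂ) + Complex.I * δ) with hw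
  have e : w.im = Real.pi / L * δ := by
    rw [hw, Complex.im_ofReal_mul]
    simp
  have h1 := norm_cot_add_I_le (w := w) (by rw [e]; positivity)
  rw [e] at h1
  have h2 : ‖Complex.cot w‖ ≤ ‖Complex.cot w + Complex.I‖ + 1 := by
    simpa using norm_sub_le (Complex.cot w + Complex.I) Complex.I
  gcongr
  linarith

/-! ### The operators `T` and `T̃` on smooth periodic functions -/

theorem exists_bound_of_periodic {L : ℝ} (hL : 0 < L) {f : ℝ → ℂ} (hf : Continuous f)
    (hp : Function.Periodic f L) : ∃ B : ℝ, 0 ≤ B ∧ ∀ x, ‖f x‖ ≤ B := by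
  obtain ⟨B, hB⟩ := (hp.isBounded_of_continuous hL.ne' hf).exists_norm_le
  have h : ∀ x, ‖f x‖ ≤ B := fun x => hB _ ⟨x, rfl⟩
  exact ⟨B, (norm_nonneg _).trans (h 0), h⟩

theorem periodic_deriv {L : ℝ} {f : ℝ → ℂ} (hp : Function.Periodic f L) :
    Function.Periodic (deriv f) L := fun x => by
  rw [← deriv_comp_add_const, funext hp]

/-- The mean value inequality over an interval of length `2s`. The factor `s` compensates the pole
`C/s` of the kernel. -/
theorem exists_symmetric_difference_bound {L : ℝ} (hL : 0 < L) {f : ℝ → ℂ} (hf : ContDiff ℝ ∞ f)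
    (hp : Function.Periodic f L) :
    ∃ B : ℝ, 0 ≤ B ∧ ∀ x s : ℝ, 0 ≤ s → ‖f (x + s) - f (x - s)‖ ≤ B * s := by
  obtain ⟨B, hB0, hB⟩ := exists_bound_of_periodic hL (hf.continuous_deriv (by simp))
    (periodic_deriv hp)
  refine ⟨B * 2, by positivity, fun x s hs => ?_⟩
  have h := (convex_univ (𝕜 := ℝ) (E := ℝ)).norm_image_sub_le_of_norm_deriv_le (f := f)
    (x := x - s) (y := x + s) (C := B) (fun y _ => hf.differentiable (by simp) y)
    (fun y _ => hB y) trivial trivial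
  refine h.trans (le_of_eq ?_)
  have : x + s - (x - s) = 2 * s := by ring
  rw [this, Real.norm_of_nonneg (by positivity)]
  ring

theorem intervalIntegrable_of_norm_le {a b : ℝ} {f : ℝ → ℂ} {B : ℝ} (hm : Measurable f)
    (hB : ∀ s ∈ Set.uIoc a b, ‖f s‖ ≤ B) : IntervalIntegrable f MeasureTheory.volume a b :=
  (intervalIntegrable_const (c := B)).mono_fun' hm.aestronglyMeasurable
    ((MeasureTheory.ae_restrict_iff' measurableSet_uIoc).2 (Eventually.of_forall hB))

theorem periodic_integral_shift {L : ℝ} {h : ℝ → ℂ} (hh : Function.Periodic h L) (x : ℝ) :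
    ∫ y in (-(L / 2))..(L / 2), h y = ∫ s in (-(L / 2))..(L / 2), h (x + s) := by
  have h1 := hh.intervalIntegral_add_eq (-(L / 2)) (x + -(L / 2))
  have e1 : -(L / 2) + L = L / 2 := by ring
  have e2 : x + -(L / 2) + L = x + L / 2 := by ring
  rw [e1, e2] at h1
  rw [h1, intervalIntegral.integral_comp_add_left]

theorem measurable_zeta1_ofReal {L δ : ℝ} (hL : 0 < L) (hδ : 0 < δ) :
    Measurable fun s : ℝ => zeta1 L δ s := by
  simpa using measurable_zeta1_line hL hδ (w := 0) (by simpa using hδ.le)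

theorem measurable_zeta1_shifted {L δ : ℝ} (hL : 0 < L) (hδ : 0 < δ) :
    Measurable fun s : ℝ => zeta1 L δ ((s : ℂ) + Complex.I * δ) :=
  measurable_zeta1_line hL hδ (by simp [abs_of_pos hδ])

/-- Translating over a full period moves `x` out of the kernel and into `f`, so that differentiation
in `x` acts on `f` alone. -/
theorem opTt_eq {L δ : ℝ} (hL : 0 < L) {f : ℝ → ℂ} (hp : Function.Periodic f L) (x : ℝ) :
    opTt L δ f x = ((1 / Real.pi : ℝ) : ℂ) *
      ∫ s in (-(L / 2))..(L / 2), zeta1 L δ ((s : ℂ) + Complex.I * δ) * f (x + s) := by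
  unfold opTt
  congr 1
  rw [periodic_integral_shift (x := x)]
  · simp
  · intro y
    simp only []
    rw [hp, ← zeta1_add_period hL δ (((y - x : ℝ) : ℂ) + _)]
    congr 2
    push_cast
    ring

/-- The complement of the `ε`-neighbourhood of the lattice `Lℤ`. -/
def awayFromLattice (L ε : ℝ) : Set ℝ := {s : ℝ | ∀ m : ℤ, ε < |s - (m : ℝ) * L|}

theorem measurableSet_awayFromLattice (L ε : ℝ) : MeasurableSet (awayFromLattice L ε) := by
  have : awayFromLattice L ε = ⋂ m : ℤ, {s : ℝ | ε < |s - (m : ℝ) * L|} := by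
    ext s
    simp [awayFromLattice]
  rw [this]
  exact MeasurableSet.iInter fun m => measurableSet_lt measurable_const (by fun_prop)

theorem add_period_mem_awayFromLattice {L ε s : ℝ} :
    s + L ∈ awayFromLattice L ε ↔ s ∈ awayFromLattice L ε := by
  constructor
  · intro h m
    have := h (m + 1)
    push_cast at this
    rwa [show s + L - ((m : ℝ) + 1) * L = s - m * L by ring] at this
  · intro h m
    have := h (m - 1)
    push_cast at this
    rwa [show s - ((m : ℝ) - 1) * L = s + L - m * L by ring] at this

theorem neg_mem_awayFromLattice {L ε s : ℝ} :
    -s ∈ awayFromLattice L ε ↔ s ∈ awayFromLattice L ε := by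
  have key : ∀ s, s ∈ awayFromLattice L ε → -s ∈ awayFromLattice L ε := by
    intro s h m
    have := h (-m)
    push_cast at this
    rwa [show s - -(m : ℝ) * L = -(-s - m * L) by ring, abs_neg] at this
  exact ⟨fun h => by simpa using key _ h, key s⟩

theorem mem_awayFromLattice_of_lt {L ε s : ℝ} (hs : 0 < s) (hsL : s ≤ L / 2) (h : ε < s) :
    s ∈ awayFromLattice L ε := by
  intro m
  refine h.trans_le ?_
  have hL : 0 < L := by linarith
  rcases le_or_gt m 0 with hm | hm
  · have : (m : ℝ) * L ≤ 0 := mul_nonpos_of_nonpos_of_nonneg (by exact_mod_cast hm) hL.le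
    exact le_trans (by linarith) (le_abs_self _)
  · have : 1 * L ≤ (m : ℝ) * L := by
      gcongr
      exact_mod_cast hm
    exact le_trans (by linarith) (neg_le_abs _)

/-- The kernel with the neighbourhoods of its poles cut out. -/
noncomputable def cutKernel (L δ ε : ℝ) : ℝ → ℂ :=
  (awayFromLattice L ε).indicator fun s : ℝ => zeta1 L δ s

theorem measurable_cutKernel {L δ : ℝ} (hL : 0 < L) (hδ : 0 < δ) (ε : ℝ) :
    Measurable (cutKernel L δ ε) :=
  (measurable_zeta1_ofReal hL hδ).indicator (measurableSet_awayFromLattice L ε)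

theorem cutKernel_neg {L δ : ℝ} (hL : 0 < L) (hδ : 0 < δ) (ε s : ℝ) :
    cutKernel L δ ε (-s) = -cutKernel L δ ε s := by
  unfold cutKernel
  by_cases h : s ∈ awayFromLattice L ε
  · rw [Set.indicator_of_mem h, Set.indicator_of_mem (neg_mem_awayFromLattice.2 h),
      Complex.ofReal_neg, zeta1_neg hL hδ (by simpa using hδ.le)]
  · rw [Set.indicator_of_notMem h,
      Set.indicator_of_notMem fun h' => h (neg_mem_awayFromLattice.1 h'), neg_zero]

theorem cutKernel_periodic {L : ℝ} (hL : 0 < L) (δ ε : ℝ) :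
    Function.Periodic (cutKernel L δ ε) L := by
  intro s
  unfold cutKernel
  by_cases h : s ∈ awayFromLattice L ε
  · rw [Set.indicator_of_mem h, Set.indicator_of_mem (add_period_mem_awayFromLattice.2 h),
      Complex.ofReal_add, zeta1_add_period hL]
  · rw [Set.indicator_of_notMem h,
      Set.indicator_of_notMem fun h' => h (add_period_mem_awayFromLattice.1 h')]

theorem cutKernel_norm_le {L δ C ε s : ℝ} (hC0 : 0 ≤ C)
    (hC : ∀ s : ℝ, 0 < s → s ≤ L / 2 → ‖zeta1 L δ s‖ ≤ C / s) (hε : 0 < ε) (hs : 0 < s)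
    (hsL : s ≤ L / 2) : ‖cutKernel L δ ε s‖ ≤ C / ε := by
  unfold cutKernel
  by_cases h : s ∈ awayFromLattice L ε
  · rw [Set.indicator_of_mem h]
    have : ε < s := by simpa [abs_of_pos hs] using h 0
    exact (hC s hs hsL).trans (by gcongr)
  · rw [Set.indicator_of_notMem h, norm_zero]
    positivity

/-- The cut kernel is periodic, so the period can be centred at `x`; it is odd, so the left half
folds onto the right with a minus sign. -/
theorem integral_puncturedPeriod {L δ : ℝ} (hL : 0 < L) (hδ : 0 < δ) {f : ℝ → ℂ}
    (hf : Continuous f) (hp : Function.Periodic f L) (x : ℝ) {ε : ℝ} (hε : 0 < ε) :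
    ∫ y in puncturedPeriod L x ε, zeta1 L δ ((y - x : ℝ) : ℂ) * f y =
      ∫ s in (0 : ℝ)..(L / 2), cutKernel L δ ε s * (f (x + s) - f (x - s)) := by
  obtain ⟨C, hC0, hC⟩ := exists_zeta1_real_bound hL hδ
  obtain ⟨B, hB0, hB⟩ := exists_bound_of_periodic hL hf hp
  have hbound : ∀ s ∈ Set.Ioc 0 (L / 2), ∀ y, ‖cutKernel L δ ε s * f y‖ ≤ C / ε * B := by
    intro s hs y
    rw [norm_mul]
    gcongr
    · exact cutKernel_norm_le hC0 hC hε hs.1 hs.2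
    · exact hB y
  have hL2 : 0 ≤ L / 2 := by positivity
  have hset : puncturedPeriod L x ε =
      Set.Ioc (-(L / 2)) (L / 2) ∩ (fun y => y - x) ⁻¹' awayFromLattice L ε := rfl
  have hm := measurable_cutKernel hL hδ ε
  have i1 : IntervalIntegrable (fun s => cutKernel L δ ε s * f (x + s)) MeasureTheory.volume
      0 (L / 2) := by
    refine intervalIntegrable_of_norm_le (B := C / ε * B) (hm.mul (by fun_prop)) ?_
    rw [Set.uIoc_of_le hL2]
    exact fun s hs => hbound s hs _
  have i2 : IntervalIntegrable (fun s => cutKernel L δ ε s * f (x - s)) MeasureTheory.volume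
      0 (L / 2) := by
    refine intervalIntegrable_of_norm_le (B := C / ε * B) (hm.mul (by fun_prop)) ?_
    rw [Set.uIoc_of_le hL2]
    exact fun s hs => hbound s hs _
  have i3 : IntervalIntegrable (fun s => cutKernel L δ ε s * f (x + s)) MeasureTheory.volume
      (-(L / 2)) 0 := by
    rw [IntervalIntegrable.iff_comp_neg]
    simp only [cutKernel_neg hL hδ, neg_mul, neg_neg, neg_zero, ← sub_eq_add_neg]
    exact i2.symm.neg
  calc ∫ y in puncturedPeriod L x ε, zeta1 L δ ((y - x : ℝ) : ℂ) * f y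
      = ∫ y in (-(L / 2))..(L / 2), cutKernel L δ ε (y - x) * f y := by
        have hms : MeasurableSet ((fun y => y - x) ⁻¹' awayFromLattice L ε) :=
          (measurable_id.sub_const x) (measurableSet_awayFromLattice L ε)
        rw [hset, ← MeasureTheory.setIntegral_indicator hms,
          intervalIntegral.integral_of_le (by linarith)]
        congr 1
        funext y
        by_cases h : y - x ∈ awayFromLattice L ε
        · simp [cutKernel, Set.indicator, h]
        · simp [cutKernel, Set.indicator, h]
    _ = ∫ s in (-(L / 2))..(L / 2), cutKernel L δ ε s * f (x + s) := by
        rw [periodic_integral_shift (x := x)]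
        · simp
        · intro y
          simp only []
          rw [hp, show y + L - x = y - x + L by ring, cutKernel_periodic hL]
    _ = (∫ s in (-(L / 2))..0, cutKernel L δ ε s * f (x + s)) +
          ∫ s in (0 : ℝ)..(L / 2), cutKernel L δ ε s * f (x + s) :=
        (intervalIntegral.integral_add_adjacent_intervals i3 i1).symm
    _ = (∫ s in (0 : ℝ)..(L / 2), -(cutKernel L δ ε s * f (x - s))) +
          ∫ s in (0 : ℝ)..(L / 2), cutKernel L δ ε s * f (x + s) := by
        congr 1
        have := intervalIntegral.integral_comp_neg (a := 0) (b := L / 2)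
          (fun s => cutKernel L δ ε s * f (x + s))
        rw [neg_zero] at this
        rw [← this]
        congr 1
        funext s
        rw [cutKernel_neg hL hδ, ← sub_eq_add_neg, neg_mul]
    _ = _ := by
        refine (intervalIntegral.integral_add i2.neg i1).symm.trans ?_
        congr 1
        funext s
        simp only [Pi.neg_apply]
        ring

theorem norm_kernel_mul_le {C B s : ℝ} {k d : ℂ} (hs : 0 < s) (hC0 : 0 ≤ C) (hk : ‖k‖ ≤ C / s)
    (hd : ‖d‖ ≤ B * s) : ‖k * d‖ ≤ C * B := by
  rw [norm_mul]
  calc ‖k‖ * ‖d‖ ≤ C / s * (B * s) := by gcongr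
    _ = C * B := by field_simp

/-- Dominated convergence with the constant `C * B`: for fixed `s > 0` the cut no longer affects `s`
once `ε < s`. In particular, the principal value exists. -/
theorem opT_eq {L δ : ℝ} (hL : 0 < L) (hδ : 0 < δ) {f : ℝ → ℂ} (hf : ContDiff ℝ ∞ f)
    (hp : Function.Periodic f L) (x : ℝ) :
    opT L δ f x = ((1 / Real.pi : ℝ) : ℂ) *
      ∫ s in (0 : ℝ)..(L / 2), zeta1 L δ s * (f (x + s) - f (x - s)) := by
  obtain ⟨C, hC0, hC⟩ := exists_zeta1_real_bound hL hδ
  obtain ⟨B, hB0, hB⟩ := exists_symmetric_difference_bound hL hf hp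
  have hL2 : 0 ≤ L / 2 := by positivity
  have hfc := hf.continuous
  unfold opT
  congr 1
  refine Tendsto.limUnder_eq ?_
  have hlim : Tendsto
      (fun ε => ∫ s in (0 : ℝ)..(L / 2), cutKernel L δ ε s * (f (x + s) - f (x - s)))
      (𝓝[>] 0) (𝓝 (∫ s in (0 : ℝ)..(L / 2), zeta1 L δ s * (f (x + s) - f (x - s)))) := by
    refine intervalIntegral.tendsto_integral_filter_of_dominated_convergence (fun _ => C * B)
      (Eventually.of_forall fun ε => ?_) (Eventually.of_forall fun ε => ?_)
      intervalIntegrable_const ?_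
    · exact ((measurable_cutKernel hL hδ ε).mul (by fun_prop)).aestronglyMeasurable
    · refine Eventually.of_forall fun s hs => ?_
      rw [Set.uIoc_of_le hL2] at hs
      refine norm_kernel_mul_le hs.1 hC0 ?_ (hB x s hs.1.le)
      exact (norm_indicator_le_norm_self _ _).trans (hC s hs.1 hs.2)
    · refine Eventually.of_forall fun s hs => ?_
      rw [Set.uIoc_of_le hL2] at hs
      refine tendsto_const_nhds.congr' ?_
      filter_upwards [mem_nhdsWithin_of_mem_nhds (Iio_mem_nhds hs.1)] with ε hε
      rw [cutKernel, Set.indicator_of_mem (mem_awayFromLattice_of_lt hs.1 hs.2 hε)]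
  refine hlim.congr' ?_
  filter_upwards [self_mem_nhdsWithin] with ε hε
  exact (integral_puncturedPeriod hL hδ hfc hp x hε).symm

/-- In the folded form `x` occurs only in `f`, and the symmetric difference of `f'` cancels the pole
uniformly in `x`. -/
theorem hasDerivAt_opT {L δ : ℝ} (hL : 0 < L) (hδ : 0 < δ) {f : ℝ → ℂ} (hf : ContDiff ℝ ∞ f)
    (hp : Function.Periodic f L) (x : ℝ) :
    HasDerivAt (opT L δ f) (opT L δ (deriv f) x) x := by
  have hf' : ContDiff ℝ ∞ (deriv f) := (contDiff_infty_iff_deriv.1 hf).2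
  obtain ⟨C, hC0, hC⟩ := exists_zeta1_real_bound hL hδ
  obtain ⟨B, hB0, hB⟩ := exists_symmetric_difference_bound hL hf hp
  obtain ⟨B', hB0', hB'⟩ := exists_symmetric_difference_bound hL hf' (periodic_deriv hp)
  have hL2 : 0 ≤ L / 2 := by positivity
  have hfc := hf.continuous
  have hfc' := hf'.continuous
  have hm := measurable_zeta1_ofReal hL hδ
  rw [funext (opT_eq hL hδ hf hp), opT_eq hL hδ hf' (periodic_deriv hp)]
  refine HasDerivAt.const_mul _ ?_
  refine (intervalIntegral.hasDerivAt_integral_of_dominated_loc_of_deriv_le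
    (bound := fun _ => C * B') (s := Set.univ)
    (F := fun x (s : ℝ) => zeta1 L δ s * (f (x + s) - f (x - s)))
    (F' := fun x (s : ℝ) => zeta1 L δ s * (deriv f (x + s) - deriv f (x - s)))
    univ_mem (Eventually.of_forall fun y => ?_) ?_ ?_ ?_ intervalIntegrable_const ?_).2
  · exact (hm.mul (by fun_prop)).aestronglyMeasurable
  · refine intervalIntegrable_of_norm_le (B := C * B) (hm.mul (by fun_prop)) ?_
    rw [Set.uIoc_of_le hL2]
    exact fun s hs => norm_kernel_mul_le hs.1 hC0 (hC s hs.1 hs.2) (hB x s hs.1.le)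
  · exact (hm.mul (by fun_prop)).aestronglyMeasurable
  · refine Eventually.of_forall fun s hs y _ => ?_
    rw [Set.uIoc_of_le hL2] at hs
    exact norm_kernel_mul_le hs.1 hC0 (hC s hs.1 hs.2) (hB' y s hs.1.le)
  · refine Eventually.of_forall fun s _ y _ => ?_
    have hd : ∀ y, HasDerivAt f (deriv f y) y := fun y =>
      (hf.differentiable (by simp) y).hasDerivAt
    exact (((hd (y + s)).comp_add_const y s).sub ((hd (y - s)).comp_sub_const y s)).const_mul _

theorem hasDerivAt_opTt {L δ : ℝ} (hL : 0 < L) (hδ : 0 < δ) {f : ℝ → ℂ} (hf : ContDiff ℝ ∞ f)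
    (hp : Function.Periodic f L) (x : ℝ) :
    HasDerivAt (opTt L δ f) (opTt L δ (deriv f) x) x := by
  have hf' : ContDiff ℝ ∞ (deriv f) := (contDiff_infty_iff_deriv.1 hf).2
  have hfc := hf.continuous
  have hfc' := hf'.continuous
  obtain ⟨C, hC⟩ := exists_zeta1_shifted_bound hL hδ
  obtain ⟨B, hB0, hB⟩ := exists_bound_of_periodic hL hfc hp
  obtain ⟨B', hB0', hB'⟩ := exists_bound_of_periodic hL hfc' (periodic_deriv hp)
  have hC0 : 0 ≤ C := (norm_nonneg _).trans (hC 0)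
  have hm := measurable_zeta1_shifted hL hδ
  rw [funext (opTt_eq hL hp), opTt_eq hL (periodic_deriv hp)]
  refine HasDerivAt.const_mul _ ?_
  refine (intervalIntegral.hasDerivAt_integral_of_dominated_loc_of_deriv_le
    (bound := fun _ => C * B') (s := Set.univ)
    (F := fun x (s : ℝ) => zeta1 L δ ((s : ℂ) + Complex.I * δ) * f (x + s))
    (F' := fun x (s : ℝ) => zeta1 L δ ((s : ℂ) + Complex.I * δ) * deriv f (x + s))
    univ_mem (Eventually.of_forall fun y => ?_) ?_ ?_ ?_ intervalIntegrable_const ?_).2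
  · exact (hm.mul (by fun_prop)).aestronglyMeasurable
  · refine intervalIntegrable_of_norm_le (B := C * B) (hm.mul (by fun_prop)) fun s _ => ?_
    rw [norm_mul]
    gcongr
    exacts [hC s, hB _]
  · exact (hm.mul (by fun_prop)).aestronglyMeasurable
  · refine Eventually.of_forall fun s _ y _ => ?_
    rw [norm_mul]
    gcongr
    exacts [hC s, hB' _]
  · refine Eventually.of_forall fun s _ y _ => ?_
    exact (((hf.differentiable (by simp) (y + s)).hasDerivAt).comp_add_const y s).const_mul _

/-- An operator on smooth periodic functions that commutes with differentiation preserves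
smoothness. -/
theorem contDiff_of_hasDerivAt_commute {L : ℝ} {S : (ℝ → ℂ) → ℝ → ℂ}
    (hS : ∀ f : ℝ → ℂ, ContDiff ℝ ∞ f → Function.Periodic f L →
      ∀ x, HasDerivAt (S f) (S (deriv f) x) x)
    {f : ℝ → ℂ} (hf : ContDiff ℝ ∞ f) (hp : Function.Periodic f L) : ContDiff ℝ ∞ (S f) := by
  refine contDiff_infty.2 fun n => ?_
  induction n generalizing f with
  | zero =>
    exact contDiff_zero.2 (continuous_iff_continuousAt.2 fun x => (hS f hf hp x).continuousAt)
  | succ n ih =>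
    push_cast
    refine contDiff_succ_iff_deriv.2 ⟨fun x => (hS f hf hp x).differentiableAt, by simp, ?_⟩
    rw [funext fun x => (hS f hf hp x).deriv]
    exact ih (contDiff_infty_iff_deriv.1 hf).2 (periodic_deriv hp)

theorem opT_periodic {L δ : ℝ} (hL : 0 < L) (hδ : 0 < δ) {f : ℝ → ℂ} (hf : ContDiff ℝ ∞ f)
    (hp : Function.Periodic f L) : Function.Periodic (opT L δ f) L := by
  intro x
  simp only [opT_eq hL hδ hf hp, add_right_comm x L, add_sub_right_comm x L, hp _]

theorem opTt_periodic {L δ : ℝ} (hL : 0 < L) {f : ℝ → ℂ}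
    (hp : Function.Periodic f L) : Function.Periodic (opTt L δ f) L := by
  intro x
  simp only [opTt_eq hL hp, add_right_comm x L, hp _]

/-! ### Partial derivatives of jointly smooth functions -/

theorem Smooth.contDiff_x {f : ℝ → ℝ → ℂ} (hf : Smooth f) (t : ℝ) :
    ContDiff ℝ ∞ fun x => f x t :=
  ContDiff.comp (g := fun p : ℝ × ℝ => f p.1 p.2) hf (contDiff_prodMk_left t)

theorem Smooth.contDiff_t {f : ℝ → ℝ → ℂ} (hf : Smooth f) (x : ℝ) :
    ContDiff ℝ ∞ fun t => f x t :=
  ContDiff.comp (g := fun p : ℝ × ℝ => f p.1 p.2) hf (contDiff_prodMk_right x)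

theorem Smooth.hasDerivAt_x {f : ℝ → ℝ → ℂ} (hf : Smooth f) (x t : ℝ) :
    HasDerivAt (fun y => f y t) (dx f x t) x :=
  ((hf.contDiff_x t).differentiable (by simp) x).hasDerivAt

theorem Smooth.hasDerivAt_t {f : ℝ → ℝ → ℂ} (hf : Smooth f) (x t : ℝ) :
    HasDerivAt (fun s => f x s) (dt f x t) t :=
  ((hf.contDiff_t x).differentiable (by simp) t).hasDerivAt

theorem Smooth.dx_eq_fderiv {f : ℝ → ℝ → ℂ} (hf : Smooth f) (x t : ℝ) :
    dx f x t = fderiv ℝ (fun p : ℝ × ℝ => f p.1 p.2) (x, t) (1, 0) := by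
  have h := (ContDiff.differentiable hf (by simp) (x, t)).hasFDerivAt
  have h2 : HasDerivAt (fun y : ℝ => (y, t)) ((1 : ℝ), (0 : ℝ)) x :=
    (hasDerivAt_id x).prodMk (hasDerivAt_const x t)
  exact (h.comp_hasDerivAt x h2).deriv

theorem Smooth.dt_eq_fderiv {f : ℝ → ℝ → ℂ} (hf : Smooth f) (x t : ℝ) :
    dt f x t = fderiv ℝ (fun p : ℝ × ℝ => f p.1 p.2) (x, t) (0, 1) := by
  have h := (ContDiff.differentiable hf (by simp) (x, t)).hasFDerivAt
  have h2 : HasDerivAt (fun y : ℝ => (x, y)) ((0 : ℝ), (1 : ℝ)) t :=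
    (hasDerivAt_const t x).prodMk (hasDerivAt_id t)
  exact (h.comp_hasDerivAt t h2).deriv

theorem Smooth.contDiff_fderiv {f : ℝ → ℝ → ℂ} (hf : Smooth f) :
    ContDiff ℝ ∞ (fderiv ℝ (fun p : ℝ × ℝ => f p.1 p.2)) :=
  (contDiff_infty_iff_fderiv.1 hf).2

theorem Smooth.dx {f : ℝ → ℝ → ℂ} (hf : Smooth f) : Smooth (dx f) := by
  unfold Smooth
  simp only [hf.dx_eq_fderiv]
  exact hf.contDiff_fderiv.clm_apply contDiff_const

theorem Smooth.dt {f : ℝ → ℝ → ℂ} (hf : Smooth f) : Smooth (dt f) := by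
  unfold Smooth
  simp only [hf.dt_eq_fderiv]
  exact hf.contDiff_fderiv.clm_apply contDiff_const

theorem Smooth.dt_dx {f : ℝ → ℝ → ℂ} (hf : Smooth f) (x t : ℝ) :
    NcILW.dt (NcILW.dx f) x t = NcILW.dx (NcILW.dt f) x t := by
  have hd := hf.contDiff_fderiv.differentiable (by simp) (x, t)
  rw [hf.dx.dt_eq_fderiv, hf.dt.dx_eq_fderiv]
  simp only [hf.dx_eq_fderiv, hf.dt_eq_fderiv]
  rw [fderiv_clm_apply hd (differentiableAt_const _),
    fderiv_clm_apply hd (differentiableAt_const _)]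
  simp only [fderiv_fun_const, Pi.zero_apply, ContinuousLinearMap.comp_zero, zero_add,
    ContinuousLinearMap.flip_apply]
  have hs : IsSymmSndFDerivAt ℝ (fun p : ℝ × ℝ => f p.1 p.2) (x, t) :=
    (ContDiff.contDiffAt hf).isSymmSndFDerivAt
      (by simpa using WithTop.coe_le_coe.2 (le_top (a := (2 : ℕ∞))))
  exact hs.eq _ _

theorem Smooth.neg {f : ℝ → ℝ → ℂ} (hf : Smooth f) : Smooth fun x t => -f x t :=
  ContDiff.neg hf

theorem XPeriodic.dx {L : ℝ} {f : ℝ → ℝ → ℂ} (hp : XPeriodic L f) : XPeriodic L (dx f) :=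
  fun x t => periodic_deriv (fun y => hp y t) x

/-! ### The compatibility identity -/

/-- Cross-differentiation of the two halves of the Lax pair on one contour. -/
theorem dt_xDefect {q φ χ : ℝ → ℝ → ℂ} (hq : Smooth q) (hφs : Smooth φ) (hχs : Smooth χ)
    {W W' : ℝ → ℂ} (hW : ∀ x, HasDerivAt W (W' x) x) {μ ν A : ℂ} {t : ℝ}
    (hX : ∀ x, Complex.I * dx φ x t + (-q x t - μ) * φ x t - ν * χ x t = 0)
    (hφ : ∀ x, dt φ x t + Complex.I * dx (dx φ) x t - 2 * μ * dx φ x t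
      - Complex.I * (W x - Complex.I * dx q x t + A) * φ x t = 0)
    (hχ : ∀ x, dt χ x t + Complex.I * dx (dx χ) x t - 2 * μ * dx χ x t
      - Complex.I * (W x + Complex.I * dx q x t + A) * χ x t = 0) (x : ℝ) :
    dt (fun x t => Complex.I * dx φ x t + (-q x t - μ) * φ x t - ν * χ x t) x t =
      -(dt q x t + 2 * q x t * dx q x t + W' x) * φ x t := by
  have h1 : dt (fun x t => Complex.I * dx φ x t + (-q x t - μ) * φ x t - ν * χ x t) x t =
      Complex.I * dt (dx φ) x t + ((-dt q x t) * φ x t + (-q x t - μ) * dt φ x t)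
        - ν * dt χ x t :=
    ((((hφs.dx.hasDerivAt_t x t).const_mul _).add
      (((hq.hasDerivAt_t x t).neg.sub_const μ).mul (hφs.hasDerivAt_t x t))).sub
      ((hχs.hasDerivAt_t x t).const_mul ν)).deriv
  have h2 : dx (dt φ) x t + Complex.I * dx (dx (dx φ)) x t - 2 * μ * dx (dx φ) x t
      - (Complex.I * (W' x - Complex.I * dx (dx q) x t) * φ x t
        + Complex.I * (W x - Complex.I * dx q x t + A) * dx φ x t) = 0 := by
    have := ((((hφs.dt.hasDerivAt_x x t).add ((hφs.dx.dx.hasDerivAt_x x t).const_mul Complex.I)).sub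
      ((hφs.dx.hasDerivAt_x x t).const_mul (2 * μ))).sub
      (((((hW x).sub ((hq.dx.hasDerivAt_x x t).const_mul Complex.I)).add_const A).const_mul
        Complex.I).mul (hφs.hasDerivAt_x x t)))
    exact this.unique ((hasDerivAt_const x (0 : ℂ)).congr_of_eventuallyEq
      (Eventually.of_forall fun y => hφ y))
  have h3 : ∀ x, Complex.I * dx (dx φ) x t + ((-dx q x t) * φ x t + (-q x t - μ) * dx φ x t)
      - ν * dx χ x t = 0 := by
    intro x
    have := ((((hφs.dx.hasDerivAt_x x t).const_mul Complex.I).add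
      (((hq.hasDerivAt_x x t).neg.sub_const μ).mul (hφs.hasDerivAt_x x t))).sub
      ((hχs.hasDerivAt_x x t).const_mul ν))
    exact this.unique ((hasDerivAt_const x (0 : ℂ)).congr_of_eventuallyEq
      (Eventually.of_forall fun y => hX y))
  have h4 : Complex.I * dx (dx (dx φ)) x t
      + (((-dx (dx q) x t) * φ x t + (-dx q x t) * dx φ x t)
        + ((-dx q x t) * dx φ x t + (-q x t - μ) * dx (dx φ) x t))
      - ν * dx (dx χ) x t = 0 := by
    have := ((((hφs.dx.dx.hasDerivAt_x x t).const_mul Complex.I).add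
      (((hq.dx.hasDerivAt_x x t).neg.mul (hφs.hasDerivAt_x x t)).add
      (((hq.hasDerivAt_x x t).neg.sub_const μ).mul (hφs.dx.hasDerivAt_x x t)))).sub
      ((hχs.dx.hasDerivAt_x x t).const_mul ν))
    exact this.unique ((hasDerivAt_const x (0 : ℂ)).congr_of_eventuallyEq
      (Eventually.of_forall fun y => h3 y))
  rw [hφs.dt_dx] at h1
  rw [h1]
  -- `h2` and `hφ` eliminate `φ_tx` and `φ_t`, and `hχ` trades `νχ_t` for `νχ_xx`, `νχ_x` and `νχ`.
  -- These are expressed through `φ` by `h4`, `h3` and `hX`, the `x`-part differentiated twice, once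
  -- and not at all.
  linear_combination (norm := skip) Complex.I * h2 + (-q x t - μ) * hφ x - ν * hχ x
    - Complex.I * h4 + 2 * μ * h3 x
    + Complex.I * (W x + Complex.I * dx q x t + A) * hX x
  ring_nf
  simp only [Complex.I_sq, Complex.I_pow_three]
  ring

/-- The equation is imposed at `t₀` only, so a function affine in `t` suffices; its slope `a₁` is
the time derivative that the equation forces. -/
theorem exists_smooth_extension {a c : ℝ → ℂ} (ha : ContDiff ℝ ∞ a) (hc : ContDiff ℝ ∞ c)
    (μ : ℂ) (t₀ : ℝ) :
    ∃ Φ : ℝ → ℝ → ℂ, Smooth Φ ∧ (∀ x, Φ x t₀ = a x) ∧ (∀ x, dx Φ x t₀ = deriv a x) ∧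
      (∀ x, dt Φ x t₀ + Complex.I * dx (dx Φ) x t₀ - 2 * μ * dx Φ x t₀
        - Complex.I * c x * Φ x t₀ = 0) ∧
      ∀ L, Function.Periodic a L → Function.Periodic c L → XPeriodic L Φ := by
  have ha' : ContDiff ℝ ∞ (deriv a) := (contDiff_infty_iff_deriv.1 ha).2
  have ha'' : ContDiff ℝ ∞ (deriv (deriv a)) := (contDiff_infty_iff_deriv.1 ha').2
  set a₁ : ℝ → ℂ := fun x => -Complex.I * deriv (deriv a) x + 2 * μ * deriv a x
    + Complex.I * c x * a x with ha₁
  have hs₁ : ContDiff ℝ ∞ a₁ := by fun_prop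
  set Φ : ℝ → ℝ → ℂ := fun x t => a x + ((t - t₀ : ℝ) : ℂ) * a₁ x with hΦ
  have h0 : ∀ x, Φ x t₀ = a x := fun x => by simp [hΦ]
  have h1 : ∀ x, dx Φ x t₀ = deriv a x := fun x => by
    unfold dx
    rw [funext h0]
  have h2 : ∀ x, dx (dx Φ) x t₀ = deriv (deriv a) x := fun x => by
    rw [NcILW.dx, funext h1]
  have h3 : ∀ x, dt Φ x t₀ = a₁ x := fun x => by
    have : HasDerivAt (fun t : ℝ => a x + ((t - t₀ : ℝ) : ℂ) * a₁ x) (((1 : ℝ) : ℂ) * a₁ x) t₀ :=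
      ((((hasDerivAt_id t₀).sub_const t₀).ofReal_comp).mul_const (a₁ x)).const_add (a x)
    exact this.deriv.trans (by simp)
  refine ⟨Φ, ?_, h0, h1, fun x => ?_, fun L hap hcp x t => ?_⟩
  · have h4 : ContDiff ℝ ∞ fun p : ℝ × ℝ => ((p.2 - t₀ : ℝ) : ℂ) :=
      Complex.ofRealCLM.contDiff.comp (contDiff_snd.sub contDiff_const)
    exact (ha.comp contDiff_fst).add (h4.mul (hs₁.comp contDiff_fst))
  · rw [h0, h1, h2, h3, ha₁]
    ring
  · simp only [hΦ, ha₁, hap x, hcp x, periodic_deriv hap x, periodic_deriv (periodic_deriv hap) x]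

/-- The coefficient of the `t`-part. -/
noncomputable def tCoeff (L δ : ℝ) (f g : ℝ → ℝ → ℂ) (A₀ σ : ℂ) (t x : ℝ) : ℂ :=
  opT L δ (fun y => dx f y t) x + opTt L δ (fun y => dx g y t) x
    + σ * (Complex.I * dx f x t) + A₀

theorem contDiff_opT {L δ : ℝ} (hL : 0 < L) (hδ : 0 < δ) {f : ℝ → ℂ} (hf : ContDiff ℝ ∞ f)
    (hp : Function.Periodic f L) : ContDiff ℝ ∞ (opT L δ f) :=
  contDiff_of_hasDerivAt_commute (S := opT L δ) (fun _ h h' => hasDerivAt_opT hL hδ h h') hf hp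

theorem contDiff_opTt {L δ : ℝ} (hL : 0 < L) (hδ : 0 < δ) {f : ℝ → ℂ} (hf : ContDiff ℝ ∞ f)
    (hp : Function.Periodic f L) : ContDiff ℝ ∞ (opTt L δ f) :=
  contDiff_of_hasDerivAt_commute (S := opTt L δ) (fun _ h h' => hasDerivAt_opTt hL hδ h h') hf hp

theorem contDiff_tCoeff {L δ : ℝ} (hL : 0 < L) (hδ : 0 < δ) {f g : ℝ → ℝ → ℂ} (hf : Smooth f)
    (hg : Smooth g) (hfp : XPeriodic L f) (hgp : XPeriodic L g) (A₀ σ : ℂ) (t : ℝ) :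
    ContDiff ℝ ∞ (tCoeff L δ f g A₀ σ t) :=
  (((contDiff_opT hL hδ (hf.dx.contDiff_x t) fun y => hfp.dx y t).add
    (contDiff_opTt hL hδ (hg.dx.contDiff_x t) fun y => hgp.dx y t)).add
    (contDiff_const.mul (contDiff_const.mul (hf.dx.contDiff_x t)))).add contDiff_const

theorem periodic_tCoeff {L δ : ℝ} (hL : 0 < L) (hδ : 0 < δ) {f g : ℝ → ℝ → ℂ} (hf : Smooth f)
    (hfp : XPeriodic L f) (hgp : XPeriodic L g) (A₀ σ : ℂ) (t : ℝ) :
    Function.Periodic (tCoeff L δ f g A₀ σ t) L := by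
  intro x
  simp only [tCoeff]
  rw [opT_periodic hL hδ (hf.dx.contDiff_x t) (fun y => hfp.dx y t),
    opTt_periodic hL (f := fun y => dx g y t) (fun y => hgp.dx y t), hfp.dx x t]

/-- The left-hand side of `u_t + 2 u u_x + T u_xx + T̃ v_xx = 0`. -/
noncomputable def eqnLHS (L δ : ℝ) (u v : ℝ → ℝ → ℂ) (x t : ℝ) : ℂ :=
  dt u x t + 2 * u x t * dx u x t
    + opT L δ (fun y => dx (dx u) y t) x + opTt L δ (fun y => dx (dx v) y t) x

/-- The left-hand side of `v_t - 2 v v_x - T v_xx - T̃ u_xx = 0`. -/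
noncomputable def eqnLHS' (L δ : ℝ) (u v : ℝ → ℝ → ℂ) (x t : ℝ) : ℂ :=
  dt v x t - 2 * v x t * dx v x t
    - opT L δ (fun y => dx (dx v) y t) x - opTt L δ (fun y => dx (dx u) y t) x

theorem isSolution_iff {L δ : ℝ} {u v : ℝ → ℝ → ℂ} :
    IsSolution L δ u v ↔ ∀ x t, eqnLHS L δ u v x t = 0 ∧ eqnLHS' L δ u v x t = 0 := Iff.rfl

theorem hasDerivAt_opT_add_opTt {L δ : ℝ} (hL : 0 < L) (hδ : 0 < δ) {f g : ℝ → ℝ → ℂ}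
    (hf : Smooth f) (hg : Smooth g) (hfp : XPeriodic L f) (hgp : XPeriodic L g) (t x : ℝ) :
    HasDerivAt (fun x => opT L δ (fun y => dx f y t) x + opTt L δ (fun y => dx g y t) x)
      (opT L δ (fun y => dx (dx f) y t) x + opTt L δ (fun y => dx (dx g) y t) x) x :=
  (hasDerivAt_opT hL hδ (hf.dx.contDiff_x t) (fun y => hfp.dx y t) x).add
    (hasDerivAt_opTt hL hδ (hg.dx.contDiff_x t) (fun y => hgp.dx y t) x)

/-! ### Equivalence of the equation with compatibility -/

section LaxPair

variable {L δ : ℝ} {u v : ℝ → ℝ → ℂ} {μ ν₁ ν₂ A₀ : ℂ} {Ψ : ContourData} {t : ℝ}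

theorem dt_xDefect₀ (hL : 0 < L) (hδ : 0 < δ) (hu : Smooth u) (hv : Smooth v)
    (hup : XPeriodic L u) (hvp : XPeriodic L v) (hΨ : Ψ.IsSmooth)
    (hX : XPart u v μ ν₁ ν₂ Ψ t) (hT : TPart L δ u v μ A₀ Ψ t) (x : ℝ) :
    dt (xDefect₀ u μ ν₁ Ψ) x t = -eqnLHS L δ u v x t * Ψ.neg₀ x t := by
  have h := dt_xDefect hu hΨ.2.1 hΨ.1 (hasDerivAt_opT_add_opTt hL hδ hu hv hup hvp t)
    (μ := μ) (ν := ν₁) (A := A₀) (fun x => (hX x).1)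
    (fun x => by
      have := (hT x).2.1
      unfold TEquation at this
      linear_combination this)
    (fun x => by
      have := (hT x).1
      unfold TEquation at this
      linear_combination this) x
  refine h.trans ?_
  rw [eqnLHS]
  ring

/-- The general identity with `q = -v`: this sign change matches the exchange of the upper and lower
boundary values between `Π₀` and `Π_δ`. -/
theorem dt_xDefectδ (hL : 0 < L) (hδ : 0 < δ) (hu : Smooth u) (hv : Smooth v)
    (hup : XPeriodic L u) (hvp : XPeriodic L v) (hΨ : Ψ.IsSmooth)
    (hX : XPart u v μ ν₁ ν₂ Ψ t) (hT : TPart L δ u v μ A₀ Ψ t) (x : ℝ) :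
    dt (xDefectδ v μ ν₂ Ψ) x t = eqnLHS' L δ u v x t * Ψ.posδ x t := by
  have hdx : ∀ x t, dx (fun x t => -v x t) x t = -dx v x t := fun x t =>
    (hv.hasDerivAt_x x t).neg.deriv
  have hdt : ∀ x t, dt (fun x t => -v x t) x t = -dt v x t := fun x t =>
    (hv.hasDerivAt_t x t).neg.deriv
  have h := dt_xDefect hv.neg hΨ.2.2.1 hΨ.2.2.2 (hasDerivAt_opT_add_opTt hL hδ hv hu hvp hup t)
    (μ := μ) (ν := ν₂) (A := A₀)
    (fun x => by
      have := (hX x).2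
      unfold xDefectδ at this
      linear_combination this)
    (fun x => by
      have := (hT x).2.2.1
      unfold TEquation at this
      rw [hdx]
      linear_combination this)
    (fun x => by
      have := (hT x).2.2.2
      unfold TEquation at this
      rw [hdx]
      linear_combination this) x
  have e : xDefectδ v μ ν₂ Ψ = fun x t => Complex.I * dx Ψ.posδ x t
      + (-(-v x t) - μ) * Ψ.posδ x t - ν₂ * Ψ.negδ x t := by
    funext x t
    rw [neg_neg]
    rfl
  rw [e, h, hdx, hdt, eqnLHS']
  ring

theorem compatible_of_isSolution (hL : 0 < L) (hδ : 0 < δ) (hu : Smooth u) (hv : Smooth v)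
    (hup : XPeriodic L u) (hvp : XPeriodic L v) (h : IsSolution L δ u v) :
    Compatible L δ u v μ ν₁ ν₂ A₀ := by
  intro Ψ t hΨ hX hT x
  have h' := isSolution_iff.1 h x t
  rw [dt_xDefect₀ hL hδ hu hv hup hvp hΨ hX hT, dt_xDefectδ hL hδ hu hv hup hvp hΨ hX hT,
    h'.1, h'.2]
  simp

/-- Data at a fixed time with prescribed values, satisfying the `t`-part there. -/
theorem exists_contourData (hL : 0 < L) (hδ : 0 < δ) (hu : Smooth u) (hv : Smooth v)
    (hup : XPeriodic L u) (hvp : XPeriodic L v) (μ A₀ : ℂ) (t : ℝ) {a b c d : ℝ → ℂ}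
    (ha : ContDiff ℝ ∞ a) (hb : ContDiff ℝ ∞ b) (hc : ContDiff ℝ ∞ c) (hd : ContDiff ℝ ∞ d) :
    ∃ Ψ : ContourData, Ψ.IsSmooth ∧ TPart L δ u v μ A₀ Ψ t ∧
      (∀ x, Ψ.pos₀ x t = a x ∧ Ψ.neg₀ x t = b x ∧ Ψ.posδ x t = c x ∧ Ψ.negδ x t = d x) ∧
      (∀ x, dx Ψ.neg₀ x t = deriv b x ∧ dx Ψ.posδ x t = deriv c x) ∧
      (Function.Periodic a L → Function.Periodic b L → Function.Periodic c L →
        Function.Periodic d L → Ψ.IsPeriodic L) := by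
  obtain ⟨Φa, sa, ea, -, ta, pa⟩ :=
    exists_smooth_extension ha (contDiff_tCoeff hL hδ hu hv hup hvp A₀ 1 t) μ t
  obtain ⟨Φb, sb, eb, db, tb, pb⟩ :=
    exists_smooth_extension hb (contDiff_tCoeff hL hδ hu hv hup hvp A₀ (-1) t) μ t
  obtain ⟨Φc, sc, ec, dc, tc, pc⟩ :=
    exists_smooth_extension hc (contDiff_tCoeff hL hδ hv hu hvp hup A₀ 1 t) μ t
  obtain ⟨Φd, sd, ed, -, td, pd⟩ :=
    exists_smooth_extension hd (contDiff_tCoeff hL hδ hv hu hvp hup A₀ (-1) t) μ t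
  refine ⟨⟨Φa, Φb, Φc, Φd⟩, ⟨sa, sb, sc, sd⟩, fun x => ⟨ta x, tb x, tc x, td x⟩,
    fun x => ⟨ea x, eb x, ec x, ed x⟩, fun x => ⟨db x, dc x⟩, fun h1 h2 h3 h4 => ⟨?_, ?_, ?_, ?_⟩⟩
  · exact pa L h1 (periodic_tCoeff hL hδ hu hup hvp _ _ _)
  · exact pb L h2 (periodic_tCoeff hL hδ hu hup hvp _ _ _)
  · exact pc L h3 (periodic_tCoeff hL hδ hv hvp hup _ _ _)
  · exact pd L h4 (periodic_tCoeff hL hδ hv hvp hup _ _ _)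

/-- A nowhere vanishing smooth solution of `φ' = g φ`. -/
theorem exists_exponential_solution {g : ℝ → ℂ} (hg : ContDiff ℝ ∞ g) :
    ∃ φ : ℝ → ℂ, ContDiff ℝ ∞ φ ∧ (∀ x, deriv φ x = g x * φ x) ∧ ∀ x, φ x ≠ 0 := by
  have hG : ∀ x, HasDerivAt (fun x => ∫ y in (0 : ℝ)..x, g y) (g x) x := fun x =>
    intervalIntegral.integral_hasDerivAt_right (hg.continuous.intervalIntegrable _ _)
      (hg.continuous.stronglyMeasurableAtFilter _ _) hg.continuous.continuousAt
  have hGs : ContDiff ℝ ∞ fun x => ∫ y in (0 : ℝ)..x, g y := by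
    refine contDiff_infty_iff_deriv.2 ⟨fun x => (hG x).differentiableAt, ?_⟩
    rwa [funext fun x => (hG x).deriv]
  refine ⟨fun x => Complex.exp (∫ y in (0 : ℝ)..x, g y), hGs.cexp, fun x => ?_,
    fun x => Complex.exp_ne_zero _⟩
  rw [(hG x).cexp.deriv, mul_comm]

/-- With `ψ⁺ = 0` on `Π₀` and `ψ⁻ = 0` on `Π_δ`, the `x`-part decouples into two linear ODEs
whatever `ν₁`, `ν₂` are. Their exponential solutions can be cancelled at every point, but need not
be periodic. -/
theorem isSolution_of_compatible (hL : 0 < L) (hδ : 0 < δ) (hu : Smooth u) (hv : Smooth v)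
    (hup : XPeriodic L u) (hvp : XPeriodic L v) (h : Compatible L δ u v μ ν₁ ν₂ A₀) :
    IsSolution L δ u v := by
  refine isSolution_iff.2 fun x t => ?_
  have hus := hu.contDiff_x t
  have hvs := hv.contDiff_x t
  obtain ⟨b, hb, hb', hb0⟩ := exists_exponential_solution
    (g := fun x => -Complex.I * (u x t + μ)) (by fun_prop)
  obtain ⟨c, hc, hc', hc0⟩ := exists_exponential_solution
    (g := fun x => Complex.I * (v x t - μ)) (by fun_prop)
  have hz : ContDiff ℝ ∞ fun _ : ℝ => (0 : ℂ) := contDiff_const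
  obtain ⟨Ψ, hΨ, hT, hval, hder, -⟩ := exists_contourData hL hδ hu hv hup hvp μ A₀ t hz hb hc hz
  have hX : XPart u v μ ν₁ ν₂ Ψ t := by
    intro x
    obtain ⟨h1, h2, h3, h4⟩ := hval x
    rw [xDefect₀, xDefectδ, h1, h2, h3, h4, (hder x).1, (hder x).2, hb', hc']
    constructor
    · linear_combination (-(u x t + μ) * b x) * Complex.I_mul_I
    · linear_combination ((v x t - μ) * c x) * Complex.I_mul_I
  have key := h Ψ t hΨ hX hT x
  rw [dt_xDefect₀ hL hδ hu hv hup hvp hΨ hX hT, dt_xDefectδ hL hδ hu hv hup hvp hΨ hX hT,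
    (hval x).2.1, (hval x).2.2.1] at key
  simpa [hb0 x, hc0 x] using key

/-- The differentiated boundary values are set to `1`, and the `x`-part is solved algebraically for
the other two, which inherit periodicity from `u` and `v`. -/
theorem isSolution_of_compatiblePeriodic (hL : 0 < L) (hδ : 0 < δ) (hu : Smooth u) (hv : Smooth v)
    (hup : XPeriodic L u) (hvp : XPeriodic L v) (hν₁ : ν₁ ≠ 0) (hν₂ : ν₂ ≠ 0)
    (h : CompatiblePeriodic L δ u v μ ν₁ ν₂ A₀) : IsSolution L δ u v := by
  refine isSolution_iff.2 fun x t => ?_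
  have hus := hu.contDiff_x t
  have hvs := hv.contDiff_x t
  have h1 : ContDiff ℝ ∞ fun _ : ℝ => (1 : ℂ) := contDiff_const
  obtain ⟨Ψ, hΨ, hT, hval, hder, hper⟩ := exists_contourData hL hδ hu hv hup hvp μ A₀ t
    (a := fun x => (-u x t - μ) / ν₁) (d := fun x => (v x t - μ) / ν₂) (by fun_prop) h1 h1
    (by fun_prop)
  have hX : XPart u v μ ν₁ ν₂ Ψ t := by
    intro x
    obtain ⟨h1, h2, h3, h4⟩ := hval x
    rw [xDefect₀, xDefectδ, h1, h2, h3, h4, (hder x).1, (hder x).2, deriv_const]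
    constructor <;> field_simp <;> ring
  have hP : Ψ.IsPeriodic L := hper (fun y => by simp only [hup y t]) (fun _ => rfl) (fun _ => rfl)
    (fun y => by simp only [hvp y t])
  have key := h Ψ t hΨ hP hX hT x
  rw [dt_xDefect₀ hL hδ hu hv hup hvp hΨ hX hT, dt_xDefectδ hL hδ hu hv hup hvp hΨ hX hT,
    (hval x).2.1, (hval x).2.2.1] at key
  simpa using key

end LaxPair

/-! ### Vanishing of eigenfunctions on the torus -/

theorem strip_subset_offContour {δ a b : ℝ} (hδ : 0 < δ) (n : ℤ) (ha : a = n * δ)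
    (hb : b = (n + 1) * δ) : {z : ℂ | a < z.im ∧ z.im < b} ⊆ offContour δ := by
  rintro z ⟨h1, h2⟩ m hm
  rw [hm, ha] at h1
  rw [hm, hb] at h2
  have h1' : n < m := by exact_mod_cast lt_of_mul_lt_mul_right h1 hδ.le
  have h2' : m < n + 1 := by exact_mod_cast lt_of_mul_lt_mul_right h2 hδ.le
  omega

/-- Translation by a multiple of `2iδ` into one of the two strips next to the real line. -/
theorem exists_translate_mem_strip {δ : ℝ} (hδ : 0 < δ) {z : ℂ} (hz : z ∈ offContour δ) :
    ∃ n : ℤ, (-δ < (z - n * (2 * Complex.I * δ)).im ∧ (z - n * (2 * Complex.I * δ)).im < 0) ∨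
      (0 < (z - n * (2 * Complex.I * δ)).im ∧ (z - n * (2 * Complex.I * δ)).im < δ) := by
  -- This `n` puts `Im z - 2nδ` in `[-δ, δ)`; the values `-δ` and `0` are excluded because `z` lies
  -- off the contour.
  set n : ℤ := ⌊(z.im + δ) / (2 * δ)⌋ with hn
  have him : (z - n * (2 * Complex.I * δ)).im = z.im - n * (2 * δ) := by simp
  have h1 : (n : ℝ) * (2 * δ) ≤ z.im + δ := (le_div_iff₀ (by positivity)).1 (Int.floor_le _)
  have h2 : z.im + δ < (n + 1) * (2 * δ) := (div_lt_iff₀ (by positivity)).1 (Int.lt_floor_add_one _)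
  have h3 : z.im ≠ n * (2 * δ) := fun h => hz (2 * n) (by push_cast; linarith)
  have h4 : z.im ≠ n * (2 * δ) - δ := fun h => hz (2 * n - 1) (by push_cast; linarith)
  refine ⟨n, ?_⟩
  rw [him]
  rcases lt_or_gt_of_ne h3 with h | h
  · refine Or.inl ⟨?_, by linarith⟩
    rcases lt_or_gt_of_ne h4 with h' | h' <;> linarith
  · exact Or.inr ⟨by linarith, by linarith⟩

theorem neBot_nhdsWithin_im_gt {z : ℂ} {a : ℝ} (hz : z.im = a) :
    (𝓝[{w : ℂ | a < w.im}] z).NeBot := by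
  rw [← mem_closure_iff_nhdsWithin_neBot, Complex.closure_setOfPred_lt_im]
  exact hz.ge

theorem neBot_nhdsWithin_im_lt {z : ℂ} {a : ℝ} (hz : z.im = a) :
    (𝓝[{w : ℂ | w.im < a}] z).NeBot := by
  rw [← mem_closure_iff_nhdsWithin_neBot, Complex.closure_setOfPred_im_lt]
  exact hz.le

namespace IsEigenfunction

variable {L δ : ℝ} {u v : ℝ → ℝ → ℂ} {μ ν₁ ν₂ A₀ : ℂ} {ψ : ℂ → ℝ → ℂ} {Ψ : ContourData}

theorem sub_int_mul (h : IsEigenfunction L δ u v μ ν₁ ν₂ A₀ ψ Ψ) (z : ℂ) (t : ℝ) (n : ℤ) :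
    ψ (z - n * (2 * Complex.I * δ)) t = ψ z t :=
  Function.Periodic.sub_int_mul_eq (f := fun z => ψ z t) (fun z => h.periodic_imag z t) n

theorem eq_zero_of_neg₀_eq_zero (hδ : 0 < δ) (h : IsEigenfunction L δ u v μ ν₁ ν₂ A₀ ψ Ψ)
    {t p q : ℝ} (hpq : p < q) (h0 : ∀ x ∈ Set.Ioo p q, Ψ.neg₀ x t = 0) {z : ℂ}
    (hz : -δ < z.im) (hz' : z.im < 0) : ψ z t = 0 := by
  refine eq_zero_of_tendsto_zero_upper (F := fun z => ψ z t) hpq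
    ((h.analytic t).mono (strip_subset_offContour hδ (-1) (by simp) (by simp)))
    (fun x hx => ?_) hz hz'
  simpa [h0 x hx] using h.boundary_neg₀ x t

/-- The upper side of `Π_δ` is the lower edge of `δ < Im z < 2δ`, which is `-δ < Im z < 0`
translated by `2iδ`. Hence `posδ` and `neg₀` belong to the same strip. -/
theorem eq_zero_of_posδ_eq_zero (hδ : 0 < δ) (h : IsEigenfunction L δ u v μ ν₁ ν₂ A₀ ψ Ψ)
    {t p q : ℝ} (hpq : p < q) (h0 : ∀ x ∈ Set.Ioo p q, Ψ.posδ x t = 0) {z : ℂ}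
    (hz : -δ < z.im) (hz' : z.im < 0) : ψ z t = 0 := by
  rw [← h.periodic_imag]
  refine eq_zero_of_tendsto_zero_lower (F := fun z => ψ z t) (a := δ) (b := 2 * δ) hpq
    ((h.analytic t).mono (strip_subset_offContour hδ 1 (by simp) (by push_cast; ring)))
    (fun x hx => ?_) (by simp; linarith) (by simp; linarith)
  simpa [h0 x hx, mul_comm] using h.boundary_posδ x t

theorem eq_zero_of_pos₀_eq_zero (hδ : 0 < δ) (h : IsEigenfunction L δ u v μ ν₁ ν₂ A₀ ψ Ψ)
    {t : ℝ} (h0 : ∀ x, Ψ.pos₀ x t = 0) {z : ℂ} (hz : 0 < z.im) (hz' : z.im < δ) :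
    ψ z t = 0 := by
  refine eq_zero_of_tendsto_zero_lower (F := fun z => ψ z t) zero_lt_one
    ((h.analytic t).mono (strip_subset_offContour hδ 0 (by simp) (by simp)))
    (fun x hx => ?_) hz hz'
  simpa [h0 x] using h.boundary_pos₀ x t

theorem eq_zero_of_negδ_eq_zero (hδ : 0 < δ) (h : IsEigenfunction L δ u v μ ν₁ ν₂ A₀ ψ Ψ)
    {t : ℝ} (h0 : ∀ x, Ψ.negδ x t = 0) {z : ℂ} (hz : 0 < z.im) (hz' : z.im < δ) :
    ψ z t = 0 := by
  refine eq_zero_of_tendsto_zero_upper (F := fun z => ψ z t) zero_lt_one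
    ((h.analytic t).mono (strip_subset_offContour hδ 0 (by simp) (by simp)))
    (fun x hx => ?_) hz hz'
  simpa [h0 x, mul_comm] using h.boundary_negδ x t

theorem neg₀_eq_zero (hδ : 0 < δ) (h : IsEigenfunction L δ u v μ ν₁ ν₂ A₀ ψ Ψ) {t : ℝ}
    (h0 : ∀ z : ℂ, -δ < z.im → z.im < 0 → ψ z t = 0) (x : ℝ) : Ψ.neg₀ x t = 0 := by
  have := neBot_nhdsWithin_im_lt (Complex.ofReal_im x)
  refine tendsto_nhds_unique (h.boundary_neg₀ x t) (tendsto_const_nhds.congr' ?_)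
  filter_upwards [self_mem_nhdsWithin, mem_nhdsWithin_of_mem_nhds
    ((isOpen_lt continuous_const Complex.continuous_im).mem_nhds
      (show -δ < (x : ℂ).im by simpa using hδ))] with z hz hz'
  exact (h0 z hz' hz).symm

theorem posδ_eq_zero (hδ : 0 < δ) (h : IsEigenfunction L δ u v μ ν₁ ν₂ A₀ ψ Ψ) {t : ℝ}
    (h0 : ∀ z : ℂ, -δ < z.im → z.im < 0 → ψ z t = 0) (x : ℝ) : Ψ.posδ x t = 0 := by
  have him : ((x : ℂ) + Complex.I * δ).im = δ := by simp
  have := neBot_nhdsWithin_im_gt him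
  refine tendsto_nhds_unique (h.boundary_posδ x t) (tendsto_const_nhds.congr' ?_)
  filter_upwards [self_mem_nhdsWithin, mem_nhdsWithin_of_mem_nhds
    ((isOpen_lt Complex.continuous_im continuous_const).mem_nhds
      (show ((x : ℂ) + Complex.I * δ).im < 2 * δ by rw [him]; linarith))] with z hz hz'
  have hz1 : δ < z.im := hz
  have hz2 : z.im < 2 * δ := hz'
  rw [← h.sub_int_mul z t 1, h0] <;> simp <;> linarith

/-- Under the non-vanishing hypothesis, an eigenfunction does not vanish on the strip whose edges
carry the differentiated boundary values. -/
theorem exists_ne_zero (hδ : 0 < δ) (h : IsEigenfunction L δ u v μ ν₁ ν₂ A₀ ψ Ψ) {t : ℝ}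
    (hne : ∃ z ∈ offContour δ, ψ z t ≠ 0 ∧ (ν₁ = 0 → ν₂ = 0 → -δ < z.im ∧ z.im < 0)) :
    ∃ z : ℂ, (-δ < z.im ∧ z.im < 0) ∧ ψ z t ≠ 0 := by
  by_contra! hlow
  have hlow' : ∀ z : ℂ, -δ < z.im → z.im < 0 → ψ z t = 0 := fun z h1 h2 => hlow z ⟨h1, h2⟩
  have hn := h.neg₀_eq_zero hδ hlow'
  have hp := h.posδ_eq_zero hδ hlow'
  obtain ⟨z, hz, hz0, hzν⟩ := hne
  -- Vanishing on the lower strip kills `neg₀` and `posδ` with their `x`-derivatives, so only the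
  -- right-hand sides of the `x`-part remain. A nonzero `ν₁` or `ν₂` then spreads the vanishing to
  -- the upper strip.
  have hX₁ : ∀ x, ν₁ * Ψ.pos₀ x t = 0 := by
    intro x
    have h1 := (h.xPart t x).1
    rw [xDefect₀, dx, funext hn, hn] at h1
    simpa using h1
  have hX₂ : ∀ x, ν₂ * Ψ.negδ x t = 0 := by
    intro x
    have h1 := (h.xPart t x).2
    rw [xDefectδ, dx, funext hp, hp] at h1
    simpa using h1
  by_cases hν : ν₁ = 0 ∧ ν₂ = 0
  · exact hz0 (hlow z (hzν hν.1 hν.2))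
  have hup : ∀ z : ℂ, 0 < z.im → z.im < δ → ψ z t = 0 := by
    intro z h1 h2
    by_cases hν₁ : ν₁ = 0
    · have hν₂ : ν₂ ≠ 0 := fun h' => hν ⟨hν₁, h'⟩
      exact h.eq_zero_of_negδ_eq_zero hδ
        (fun x => (mul_eq_zero.1 (hX₂ x)).resolve_left hν₂) h1 h2
    · exact h.eq_zero_of_pos₀_eq_zero hδ
        (fun x => (mul_eq_zero.1 (hX₁ x)).resolve_left hν₁) h1 h2
  obtain ⟨n, hn | hn⟩ := exists_translate_mem_strip hδ hz
  · exact hz0 ((h.sub_int_mul z t n).symm.trans (hlow _ hn))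
  · exact hz0 ((h.sub_int_mul z t n).symm.trans (hup _ hn.1 hn.2))

end IsEigenfunction

/-! ### From an eigenfunction to the equation -/

section Continuity

variable {L δ : ℝ} {u v : ℝ → ℝ → ℂ}

theorem continuous_eqnLHS (hL : 0 < L) (hδ : 0 < δ) (hu : Smooth u) (hv : Smooth v)
    (hup : XPeriodic L u) (hvp : XPeriodic L v) (t : ℝ) :
    Continuous fun x => eqnLHS L δ u v x t := by
  have h1 := (contDiff_opT hL hδ (hu.dx.dx.contDiff_x t) fun y => hup.dx.dx y t).continuous
  have h2 := (contDiff_opTt hL hδ (hv.dx.dx.contDiff_x t) fun y => hvp.dx.dx y t).continuous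
  have h3 := (hu.contDiff_x t).continuous
  have h4 := (hu.dx.contDiff_x t).continuous
  have h5 := (hu.dt.contDiff_x t).continuous
  exact ((h5.add ((continuous_const.mul h3).mul h4)).add h1).add h2

theorem continuous_eqnLHS' (hL : 0 < L) (hδ : 0 < δ) (hu : Smooth u) (hv : Smooth v)
    (hup : XPeriodic L u) (hvp : XPeriodic L v) (t : ℝ) :
    Continuous fun x => eqnLHS' L δ u v x t := by
  have h1 := (contDiff_opT hL hδ (hv.dx.dx.contDiff_x t) fun y => hvp.dx.dx y t).continuous
  have h2 := (contDiff_opTt hL hδ (hu.dx.dx.contDiff_x t) fun y => hup.dx.dx y t).continuous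
  have h3 := (hv.contDiff_x t).continuous
  have h4 := (hv.dx.contDiff_x t).continuous
  have h5 := (hv.dt.contDiff_x t).continuous
  exact ((h5.sub ((continuous_const.mul h3).mul h4)).sub h1).sub h2

end Continuity

/-- If `f g = 0` with `f` continuous and `f` is not zero, then `g` vanishes on an interval. -/
theorem exists_Ioo_eq_zero_of_mul_eq_zero {f g : ℝ → ℂ} (hf : Continuous f)
    (hfg : ∀ x, f x * g x = 0) {x : ℝ} (hx : f x ≠ 0) :
    ∃ p q : ℝ, p < q ∧ ∀ y ∈ Set.Ioo p q, g y = 0 := by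
  obtain ⟨p, q, hm, hpq⟩ := mem_nhds_iff_exists_Ioo_subset.1
    ((isOpen_ne_fun hf continuous_const).mem_nhds hx)
  exact ⟨p, q, hm.1.trans hm.2, fun y hy => (mul_eq_zero.1 (hfg y)).resolve_left (hpq hy)⟩

theorem isSolution_of_isEigenfunction {L δ : ℝ} {u v : ℝ → ℝ → ℂ} {μ ν₁ ν₂ A₀ : ℂ}
    {ψ : ℂ → ℝ → ℂ} {Ψ : ContourData} (hL : 0 < L) (hδ : 0 < δ) (hu : Smooth u) (hv : Smooth v)
    (hup : XPeriodic L u) (hvp : XPeriodic L v) (h : IsEigenfunction L δ u v μ ν₁ ν₂ A₀ ψ Ψ)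
    (hne : ∀ t : ℝ, ∃ z ∈ offContour δ, ψ z t ≠ 0 ∧
      (ν₁ = 0 → ν₂ = 0 → -δ < z.im ∧ z.im < 0)) : IsSolution L δ u v := by
  refine isSolution_iff.2 fun x t => ?_
  obtain ⟨z, ⟨hz1, hz2⟩, hz0⟩ := h.exists_ne_zero hδ (hne t)
  have e₁ : ∀ x, eqnLHS L δ u v x t * Ψ.neg₀ x t = 0 := by
    intro x
    have h1 := dt_xDefect₀ hL hδ hu hv hup hvp h.smooth (h.xPart t) (h.tPart t) x
    -- The `x`-part holds for all times, so its defect has zero `t`-derivative.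
    rw [dt, funext fun s => (h.xPart s x).1, deriv_const] at h1
    linear_combination h1
  have e₂ : ∀ x, eqnLHS' L δ u v x t * Ψ.posδ x t = 0 := by
    intro x
    have h1 := dt_xDefectδ hL hδ hu hv hup hvp h.smooth (h.xPart t) (h.tPart t) x
    rw [dt, funext fun s => (h.xPart s x).2, deriv_const] at h1
    exact h1.symm
  constructor
  · by_contra hx
    obtain ⟨p, q, hpq, h0⟩ := exists_Ioo_eq_zero_of_mul_eq_zero
      (continuous_eqnLHS hL hδ hu hv hup hvp t) e₁ hx
    exact hz0 (h.eq_zero_of_neg₀_eq_zero hδ hpq h0 hz1 hz2)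
  · by_contra hx
    obtain ⟨p, q, hpq, h0⟩ := exists_Ioo_eq_zero_of_mul_eq_zero
      (continuous_eqnLHS' hL hδ hu hv hup hvp t) e₂ hx
    exact hz0 (h.eq_zero_of_posδ_eq_zero hδ hpq h0 hz1 hz2)

end NcILW

theorem mainTheorem1 (L δ : ℝ) (hL : 0 < L) (hδ : 0 < δ) (u v : ℝ → ℝ → ℂ)
    (hu : NcILW.Smooth u) (hv : NcILW.Smooth v)
    (hup : NcILW.XPeriodic L u) (hvp : NcILW.XPeriodic L v)
    (μ ν₁ ν₂ A₀ : ℂ → ℂ) (k : ℂ) :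
    (NcILW.IsSolution L δ u v ↔ NcILW.Compatible L δ u v (μ k) (ν₁ k) (ν₂ k) (A₀ k)) ∧
    (ν₁ k ≠ 0 → ν₂ k ≠ 0 →
      (NcILW.IsSolution L δ u v ↔
        NcILW.CompatiblePeriodic L δ u v (μ k) (ν₁ k) (ν₂ k) (A₀ k))) ∧
    (∀ (ψ : ℂ → ℝ → ℂ) (Ψ : NcILW.ContourData),
      NcILW.IsEigenfunction L δ u v (μ k) (ν₁ k) (ν₂ k) (A₀ k) ψ Ψ →
      (∀ t : ℝ, ∃ z ∈ NcILW.offContour δ, ψ z t ≠ 0 ∧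
        (ν₁ k = 0 → ν₂ k = 0 → -δ < z.im ∧ z.im < 0)) →
      NcILW.IsSolution L δ u v) := by
  have hcomp := NcILW.compatible_of_isSolution (μ := μ k) (ν₁ := ν₁ k) (ν₂ := ν₂ k) (A₀ := A₀ k)
    hL hδ hu hv hup hvp
  refine ⟨⟨hcomp, NcILW.isSolution_of_compatible hL hδ hu hv hup hvp⟩, fun h₁ h₂ => ⟨?_, ?_⟩, ?_⟩
  · exact fun h Ψ t hΨ _ => hcomp h Ψ t hΨ
  · exact NcILW.isSolution_of_compatiblePeriodic hL hδ hu hv hup hvp h₁ h₂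
  · exact fun ψ Ψ h hne => NcILW.isSolution_of_isEigenfunction hL hδ hu hv hup hvp h hne
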